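/- Let $(M,g)$ be a (pseudo-)Riemannian manifold with Levi-Civita connection $\nabla$, and let $S\to M$ be a (real or complex, possibly twisted) spinor bundle, or more generally any smooth vector bundle with a smooth Clifford multiplication $\gamma:TM\to\mathrm{End}(S)$, $XY+YX=-2g(X,Y)$, together with a charge conjugation $C$, i.e. a smooth nondegenerate bilinear form on $S$ with $C(\varphi,\psi)=\Delta_0C(\psi,\varphi)$ and $C(\varphi,X\psi)=\Delta_1C(\psi,X\varphi)$ for fixed signs $\Delta_0,\Delta_1\in\{\pm1\}$. Let $D$ be a smooth connection on $S$ with curvature $R$, and let $D^C$ be the connection on $S$ determined by $X(C(\varphi,\psi))=C(D_X\varphi,\psi)+C(\varphi,D^C_X\psi)$. Put $(\hat D_X\gamma)(Y)\xi=D_X(Y\xi)-(\nabla_XY)\xi-Y\,D^C_X\xi$ and let $\mathcal T(X,Y)=(\hat D_X\gamma)(Y)-(\hat D_Y\gamma)(X)$ be the torsion of $D$. For a local frame $e_\mu$ with $g$-dual frame $e^\mu$ write $\gamma^\mu=\gamma(e^\mu)$, $R_{\mu\nu}=R(e_\mu,e_\nu)$, $\mathcal T_{\mu\nu}=\mathcal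 T(e_\mu,e_\nu)$, and for spinor fields $\varphi,\psi$ set $$\mathfrak B(R;\varphi,\psi)=\gamma^\mu\varphi\wedge\gamma^\nu\psi\wedge R_{\mu\nu}\in\Gamma\,\mathrm{Hom}(S,\Lambda^3S),$$ $$\mathfrak D(\mathcal T;\varphi,\psi)=\big(\gamma^\mu\varphi\wedge\mathcal T_{\mu\nu}\psi+\gamma^\mu\psi\wedge\mathcal T_{\mu\nu}\varphi\big)\otimes e^\nu\in\Gamma(\Lambda^2S\otimes TM).$$ Let $\eta$ be a smooth section of $S$ with $D^C\eta=0$ such that $(D,\{\eta\})$ is admissible, i.e. $(\hat D_X\gamma)(Y)\eta+(\hat D_Y\gamma)(X)\eta=0$ for all $X,Y$. Then there is exactly one odd vector field $\imath(\eta)=\gamma^\mu\eta\otimes D_\mu$ on the graded manifold $(M,\Gamma\Lambda S)$, i.e. exactly one odd superderivation of $\Gamma\Lambda S$ with $$\imath(\eta)f=df(e_\mu)\,\gamma^\mu\eta\quad(f\in C^\infty(M)),\qquad \imath(\eta)\psi=\gamma^\mu\eta\wedge D_{e_\mu}\psi\quad(\psi\in\Gamma S),$$ and it is a differential, $\imath(\eta)\circ\imath(\eta)=0$,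 if and only if $(D,\{\eta\})$ is flat, i.e. $\mathfrak B(R;\eta,\eta)=0$ and $\mathfrak D(\mathcal T;\eta,\eta)=0$. -/

import Mathlib

open Bundle Manifold
open scoped ContDiff Topology TensorProduct

noncomputable section

namespace SpinSuper

section Geometry

variable {E : Type*} [NormedAddCommGroup E] [NormedSpace ℝ E] [FiniteDimensional ℝ E]
  {M : Type*} [TopologicalSpace M] [ChartedSpace E M] [IsManifold 𝓘(ℝ, E) ∞ M]

/-- A smooth pseudo-Riemannian metric on `M`: a smooth family of symmetric nondegenerate bilinear
forms on the tangent spaces, of arbitrary signature. -/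
structure PseudoRiemannianMetric (E : Type*) [NormedAddCommGroup E] [NormedSpace ℝ E]
    (M : Type*) [TopologicalSpace M] [ChartedSpace E M] [IsManifold 𝓘(ℝ, E) ∞ M] where
  /-- The bilinear form `g x` on `T_x M`. -/
  val (x : M) : TangentSpace 𝓘(ℝ, E) x →L[ℝ] TangentSpace 𝓘(ℝ, E) x →L[ℝ] ℝ
  symm (x : M) (v w : TangentSpace 𝓘(ℝ, E) x) : val x v w = val x w v
  nondegenerate (x : M) (v : TangentSpace 𝓘(ℝ, E) x) (hv : ∀ w, val x v w = 0) : v = 0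
  contMDiff : ContMDiff 𝓘(ℝ, E) (𝓘(ℝ, E).prod 𝓘(ℝ, E →L[ℝ] E →L[ℝ] ℝ)) ∞
    (fun x ↦ TotalSpace.mk' (E →L[ℝ] E →L[ℝ] ℝ) x (val x))

namespace PseudoRiemannianMetric

variable (g : PseudoRiemannianMetric E M)

/-- The form `g x` as an algebraic bilinear form. -/
def bilin (x : M) : LinearMap.BilinForm ℝ (TangentSpace 𝓘(ℝ, E) x) :=
  LinearMap.mk₂ ℝ (fun v w ↦ g.val x v w) (by simp) (by simp) (by simp) (by simp)

theorem bilin_nondegenerate (x : M) : (g.bilin x).Nondegenerate := by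
  constructor
  · intro v hv
    exact g.nondegenerate x v hv
  · intro v hv
    exact g.nondegenerate x v (fun w ↦ (g.symm x v w).trans (hv w))

/-- A basis `e_μ` of `T_x M`. -/
def frame (x : M) : Module.Basis (Fin (Module.finrank ℝ E)) ℝ (TangentSpace 𝓘(ℝ, E) x) :=
  Module.finBasis ℝ E

/-- The dual basis `e^μ` of `T_x M`: `g(e^μ, e_ν) = δ^μ_ν`. -/
def coframe (x : M) : Module.Basis (Fin (Module.finrank ℝ E)) ℝ (TangentSpace 𝓘(ℝ, E) x) :=
  (g.bilin x).dualBasis (g.bilin_nondegenerate x) (frame x)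

/-- The metric contraction `∑_μ f(e^μ, e_μ)`. For bilinear `f`, the only case in which it is used,
it does not depend on the basis `e_μ`. -/
def contract {W : Type*} [AddCommMonoid W] (x : M)
    (f : TangentSpace 𝓘(ℝ, E) x → TangentSpace 𝓘(ℝ, E) x → W) : W :=
  ∑ μ, f (g.coframe x μ) (frame x μ)

/-- `∇` is the Levi-Civita connection of `g`: it is torsion free and metric. -/
def IsLeviCivita (nabla : CovariantDerivative 𝓘(ℝ, E) E (TangentSpace 𝓘(ℝ, E) : M → Type _)) :
    Prop :=
  (∀ (X Y : Π x : M, TangentSpace 𝓘(ℝ, E) x) (x : M), MDiffAt (T% X) x → MDiffAt (T% Y) x →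
    nabla Y x (X x) - nabla X x (Y x) = VectorField.mlieBracket 𝓘(ℝ, E) X Y x) ∧
  (∀ (Y Z : Π x : M, TangentSpace 𝓘(ℝ, E) x) (x : M), MDiffAt (T% Y) x → MDiffAt (T% Z) x →
    ∀ v : TangentSpace 𝓘(ℝ, E) x,
      mvfderiv 𝓘(ℝ, E) (fun y ↦ g.val y (Y y) (Z y)) x v
        = g.val x (nabla Y x v) (Z x) + g.val x (Y x) (nabla Z x v))

end PseudoRiemannianMetric

end Geometry

section Spinors

variable {𝕜 : Type*} [RCLike 𝕜]
  {E : Type*} [NormedAddCommGroup E] [NormedSpace ℝ E] [FiniteDimensional ℝ E]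
  {M : Type*} [TopologicalSpace M] [ChartedSpace E M] [IsManifold 𝓘(ℝ, E) ∞ M]
  {F : Type*} [NormedAddCommGroup F] [NormedSpace ℝ F] [NormedSpace 𝕜 F] [IsScalarTower ℝ 𝕜 F]
  [FiniteDimensional ℝ F]
  {S : M → Type*} [TopologicalSpace (TotalSpace F S)]
  [∀ x, AddCommGroup (S x)] [∀ x, Module ℝ (S x)] [∀ x, Module 𝕜 (S x)]
  [∀ x, IsScalarTower ℝ 𝕜 (S x)]
  [∀ x, TopologicalSpace (S x)] [∀ x, IsTopologicalAddGroup (S x)] [∀ x, ContinuousSMul ℝ (S x)]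
  [FiberBundle F S] [VectorBundle ℝ F S] [VectorBundle 𝕜 F S]
  [ContMDiffVectorBundle ∞ F S 𝓘(ℝ, E)]

/-- A Clifford multiplication `γ : TM → End(S)` on a bundle `S` of `𝕜`-vector spaces, with the sign
convention `XY + YX = -2 g(X,Y)`. The spinor bundle of a spin manifold, and every twisted spinor
bundle, is a bundle `S` with such a multiplication; irreducibility of the fibres is not required. -/
structure CliffordMultiplication (𝕜 : Type*) [RCLike 𝕜]
    {E : Type*} [NormedAddCommGroup E] [NormedSpace ℝ E] [FiniteDimensional ℝ E]
    {M : Type*} [TopologicalSpace M] [ChartedSpace E M] [IsManifold 𝓘(ℝ, E) ∞ M]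
    (g : PseudoRiemannianMetric E M)
    (F : Type*) [NormedAddCommGroup F] [NormedSpace ℝ F]
    (S : M → Type*) [TopologicalSpace (TotalSpace F S)]
    [∀ x, AddCommGroup (S x)] [∀ x, Module ℝ (S x)] [∀ x, Module 𝕜 (S x)]
    [∀ x, TopologicalSpace (S x)] [∀ x, IsTopologicalAddGroup (S x)] [∀ x, ContinuousSMul ℝ (S x)]
    [FiberBundle F S] [VectorBundle ℝ F S] where
  /-- `mul x v s` is the Clifford product `v · s`. -/
  mul (x : M) : TangentSpace 𝓘(ℝ, E) x →L[ℝ] S x →L[ℝ] S x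
  mul_smul (x : M) (v : TangentSpace 𝓘(ℝ, E) x) (c : 𝕜) (s : S x) :
    mul x v (c • s) = c • mul x v s
  clifford (x : M) (v w : TangentSpace 𝓘(ℝ, E) x) (s : S x) :
    mul x v (mul x w s) + mul x w (mul x v s) = (-2 * g.val x v w) • s
  contMDiff : ContMDiff 𝓘(ℝ, E) (𝓘(ℝ, E).prod 𝓘(ℝ, E →L[ℝ] F →L[ℝ] F)) ∞
    (fun x ↦ TotalSpace.mk' (E →L[ℝ] F →L[ℝ] F) x (mul x))

/-- A charge conjugation: a smooth nondegenerate `𝕜`-bilinear form `C` on `S` for which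
`C(φ, ψ) = Δ₀ C(ψ, φ)` and `C(φ, Xψ) = Δ₁ C(ψ, Xφ)` with signs `Δ₀, Δ₁ ∈ {1, -1}`
(so that `C` is spin-invariant). -/
structure ChargeConjugation {g : PseudoRiemannianMetric E M}
    (γ : CliffordMultiplication 𝕜 g F S) where
  /-- The bilinear form on the fibre `S x`. -/
  form (x : M) : S x →L[ℝ] S x →L[ℝ] 𝕜
  smul_left (x : M) (c : 𝕜) (φ ψ : S x) : form x (c • φ) ψ = c * form x φ ψ
  smul_right (x : M) (c : 𝕜) (φ ψ : S x) : form x φ (c • ψ) = c * form x φ ψ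
  nondegenerate (x : M) (φ : S x) (hφ : ∀ ψ, form x φ ψ = 0) : φ = 0
  /-- The sign `Δ₀`. -/
  Δ₀ : ℤˣ
  /-- The sign `Δ₁`. -/
  Δ₁ : ℤˣ
  symm (x : M) (φ ψ : S x) : form x φ ψ = ((Δ₀ : ℤ) : 𝕜) * form x ψ φ
  symm_mul (x : M) (v : TangentSpace 𝓘(ℝ, E) x) (φ ψ : S x) :
    form x φ (γ.mul x v ψ) = ((Δ₁ : ℤ) : 𝕜) * form x ψ (γ.mul x v φ)
  contMDiff : ContMDiff 𝓘(ℝ, E) (𝓘(ℝ, E).prod 𝓘(ℝ, F →L[ℝ] F →L[ℝ] 𝕜)) ∞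
    (fun x ↦ TotalSpace.mk' (F →L[ℝ] F →L[ℝ] 𝕜) x (form x))

/-- A (smooth, `𝕜`-linear) connection on the bundle `S`; `D ψ x v` is `D_v ψ` at `x`. -/
structure SpinorConnection (𝕜 : Type*) [RCLike 𝕜]
    (E : Type*) [NormedAddCommGroup E] [NormedSpace ℝ E]
    {M : Type*} [TopologicalSpace M] [ChartedSpace E M] [IsManifold 𝓘(ℝ, E) ∞ M]
    (F : Type*) [NormedAddCommGroup F] [NormedSpace ℝ F]
    (S : M → Type*) [TopologicalSpace (TotalSpace F S)]
    [∀ x, AddCommGroup (S x)] [∀ x, Module ℝ (S x)] [∀ x, Module 𝕜 (S x)]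
    [∀ x, TopologicalSpace (S x)] [∀ x, IsTopologicalAddGroup (S x)] [∀ x, ContinuousSMul ℝ (S x)]
    [FiberBundle F S] [VectorBundle ℝ F S] extends CovariantDerivative 𝓘(ℝ, E) F S where
  map_const_smul {σ : Π x : M, S x} {x : M} (c : 𝕜) (hσ : MDiffAt (T% σ) x)
    (v : TangentSpace 𝓘(ℝ, E) x) :
    toFun (fun y ↦ c • σ y) x v = c • toFun σ x v
  smooth : CovariantDerivative.ContMDiffCovariantDerivative toCovariantDerivative ∞

namespace ChargeConjugation

variable {g : PseudoRiemannianMetric E M} {γ : CliffordMultiplication 𝕜 g F S}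
  (C : ChargeConjugation γ)

theorem mdifferentiableAt_form {φ ψ : Π x : M, S x} {x : M} (hφ : MDiffAt (T% φ) x)
    (hψ : MDiffAt (T% ψ) x) :
    MDifferentiableAt 𝓘(ℝ, E) 𝓘(ℝ, 𝕜) (fun y ↦ C.form y (φ y) (ψ y)) x := by
  have : MDifferentiableAt 𝓘(ℝ, E) (𝓘(ℝ, E).prod 𝓘(ℝ, 𝕜))
      (fun m ↦ TotalSpace.mk' 𝕜 (E := Bundle.Trivial M 𝕜) m (C.form m (φ m) (ψ m))) x := by
    apply MDifferentiableAt.clm_bundle_apply₂ (F₁ := F) (F₂ := F)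
    · exact C.contMDiff.contMDiffAt.mdifferentiableAt (by simp)
    · exact hφ
    · exact hψ
  simp only [mdifferentiableAt_totalSpace] at this
  exact this.2

/-- The functional `φ ↦ v(C(φ, ψ)) - C(D_v φ, ψ)` of sections `φ`. -/
def conjFunctional (D : SpinorConnection 𝕜 E F S) (ψ : Π x : M, S x) (x : M)
    (v : TangentSpace 𝓘(ℝ, E) x) (φ : Π x : M, S x) : 𝕜 :=
  mvfderiv 𝓘(ℝ, E) (fun y ↦ C.form y (φ y) (ψ y)) x v - C.form x (D.toFun φ x v) (ψ x)

theorem tensorialAt_conjFunctional (D : SpinorConnection 𝕜 E F S) {ψ : Π x : M, S x} {x : M}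
    (hψ : MDiffAt (T% ψ) x) (v : TangentSpace 𝓘(ℝ, E) x) :
    TensorialAt 𝓘(ℝ, E) F (C.conjFunctional D ψ x v) x where
  smul {f σ} hf hσ := by
    have h1 := mvfderiv_smul hf (C.mdifferentiableAt_form hσ hψ)
    have h2 : (fun y ↦ C.form y ((f • σ) y) (ψ y))
        = f • (fun y ↦ C.form y (σ y) (ψ y)) := by
      ext y; simp
    have h3 := D.isCovariantDerivativeOnUniv.leibniz hσ hf
    simp only [conjFunctional, h2, h1, h3]
    simp [smul_sub]
  add {σ σ'} hσ hσ' := by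
    have h1 := mvfderiv_add (C.mdifferentiableAt_form hσ hψ) (C.mdifferentiableAt_form hσ' hψ)
    have h2 : (fun y ↦ C.form y ((σ + σ') y) (ψ y))
        = (fun y ↦ C.form y (σ y) (ψ y)) + (fun y ↦ C.form y (σ' y) (ψ y)) := by
      ext y; simp
    have h3 := D.isCovariantDerivativeOnUniv.add hσ hσ'
    simp only [conjFunctional, h2, h1, h3]
    simp
    ring

/-- Two spinors with the same pairings coincide. -/
theorem ext_right {x : M} {s t : S x} (h : ∀ φ, C.form x φ s = C.form x φ t) : s = t := by
  rw [← sub_eq_zero]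
  refine C.nondegenerate x _ fun φ ↦ ?_
  rw [C.symm, map_sub, h, sub_self, mul_zero]

/-- Every `𝕜`-linear functional on `S x` is of the form `C(·, s)`. -/
theorem exists_form_eq (x : M) (ℓ : S x →ₗ[𝕜] 𝕜) : ∃ s, ∀ φ, C.form x φ s = ℓ φ := by
  have : FiniteDimensional ℝ (S x) := VectorBundle.finiteDimensional ℝ F S x
  have : FiniteDimensional 𝕜 (S x) := Module.Finite.of_restrictScalars_finite ℝ 𝕜 (S x)
  let T : S x →ₗ[𝕜] Module.Dual 𝕜 (S x) := LinearMap.mk₂ 𝕜 (fun s φ ↦ C.form x φ s)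
    (fun s t φ ↦ map_add _ _ _) (fun c s φ ↦ C.smul_right x c φ s)
    (fun s φ ψ ↦ by simp) (fun c s φ ↦ C.smul_left x c φ s)
  have hT : Function.Injective T := fun s t h ↦ C.ext_right fun φ ↦ congrArg (fun L ↦ L φ) h
  obtain ⟨s, hs⟩ := (LinearMap.injective_iff_surjective_of_finrank_eq_finrank
    (Subspace.dual_finrank_eq (K := 𝕜) (V := S x)).symm).1 hT ℓ
  exact ⟨s, fun φ ↦ congrArg (fun L ↦ L φ) hs⟩

theorem exists_conj (D : SpinorConnection 𝕜 E F S) {ψ : Π x : M, S x} {x : M}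
    (hψ : MDiffAt (T% ψ) x) :
    ∃ L : TangentSpace 𝓘(ℝ, E) x →L[ℝ] S x, ∀ (φ : Π x : M, S x), MDiffAt (T% φ) x →
      ∀ v, mvfderiv 𝓘(ℝ, E) (fun y ↦ C.form y (φ y) (ψ y)) x v
        = C.form x (D.toFun φ x v) (ψ x) + C.form x (φ x) (L v) := by
  have hconst (c : 𝕜) (φ : Π x : M, S x) (hφ : MDiffAt (T% φ) x) :
      MDiffAt (T% (fun y ↦ c • φ y)) x := by
    rw [mdifferentiableAt_totalSpace] at hφ ⊢
    refine ⟨hφ.1, ?_⟩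
    have h1 : MDifferentiableAt 𝓘(ℝ, E) 𝓘(ℝ, F)
        (fun y ↦ c • (trivializationAt F S x ⟨y, φ y⟩).2) x :=
      ((c • ContinuousLinearMap.id ℝ F).mdifferentiableAt).comp x hφ.2
    refine h1.congr_of_eventuallyEq ?_
    filter_upwards [(trivializationAt F S x).open_baseSet.mem_nhds
      (FiberBundle.mem_baseSet_trivializationAt' x)] with y hy
    exact ((trivializationAt F S x).linear 𝕜 hy).map_smul c (φ y)
  have key (v : TangentSpace 𝓘(ℝ, E) x) : ∃ s : S x, ∀ (φ : Π x : M, S x), MDiffAt (T% φ) x →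
      C.form x (φ x) s = C.conjFunctional D ψ x v φ := by
    have hten := C.tensorialAt_conjFunctional D hψ v
    let ℓ : S x →ₗ[𝕜] 𝕜 :=
      { toFun := TensorialAt.mkHom _ x hten
        map_add' := map_add _
        map_smul' := fun c s ↦ by
          have h0 := FiberBundle.mdifferentiableAt_extend 𝓘(ℝ, E) F s
          have h1 := TensorialAt.mkHom_apply hten (hconst c _ h0)
          have h2 := TensorialAt.mkHom_apply hten h0
          simp only [FiberBundle.extend_apply_self] at h1 h2
          rw [h1, h2]
          simp only [conjFunctional, D.map_const_smul c h0, C.smul_left]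
          have h3 : (fun y ↦ c * C.form y (FiberBundle.extend F s y) (ψ y))
              = c • (fun y ↦ C.form y (FiberBundle.extend F s y) (ψ y)) := rfl
          have h4 := C.mdifferentiableAt_form h0 hψ
          have h5 : mvfderiv 𝓘(ℝ, E)
              (c • (fun y ↦ C.form y (FiberBundle.extend F s y) (ψ y))) x v
              = c * mvfderiv 𝓘(ℝ, E)
                (fun y ↦ C.form y (FiberBundle.extend F s y) (ψ y)) x v := by
            have h6 := ((c • ContinuousLinearMap.id ℝ 𝕜).hasMFDerivAt).comp x h4.hasMFDerivAt
            exact congrArg (fun L ↦ L v) h6.mfderiv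
          rw [h3, h5, RingHom.id_apply, smul_eq_mul, mul_sub] }
    obtain ⟨s, hs⟩ := C.exists_form_eq x ℓ
    exact ⟨s, fun φ hφ ↦ (hs _).trans (TensorialAt.mkHom_apply hten hφ)⟩
  choose s hs using key
  have : FiniteDimensional ℝ (TangentSpace 𝓘(ℝ, E) x) := inferInstanceAs (FiniteDimensional ℝ E)
  have : T2Space (TangentSpace 𝓘(ℝ, E) x) := inferInstanceAs (T2Space E)
  let L : TangentSpace 𝓘(ℝ, E) x →ₗ[ℝ] S x :=
    { toFun := s
      map_add' := fun v w ↦ C.ext_right fun φ ↦ by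
        have h0 := FiberBundle.mdifferentiableAt_extend 𝓘(ℝ, E) F φ
        have h1 := hs v _ h0
        have h2 := hs w _ h0
        have h3 := hs (v + w) _ h0
        simp only [FiberBundle.extend_apply_self, conjFunctional, map_add] at h1 h2 h3
        rw [map_add, h1, h2, h3]
        simp
        ring
      map_smul' := fun c v ↦ C.ext_right fun φ ↦ by
        have h0 := FiberBundle.mdifferentiableAt_extend 𝓘(ℝ, E) F φ
        have h1 := hs v _ h0
        have h3 := hs (c • v) _ h0
        simp only [FiberBundle.extend_apply_self, conjFunctional, map_smul] at h1 h3
        rw [RingHom.id_apply, map_smul, h1, h3]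
        simp [smul_sub] }
  refine ⟨LinearMap.toContinuousLinearMap L, fun φ hφ v ↦ ?_⟩
  have := hs v φ hφ
  simp only [conjFunctional] at this
  change _ = _ + C.form x (φ x) (s v)
  rw [this]
  ring

open Classical in
/-- The connection `D^C`: it is determined by the requirement that `D ⊗ 1 + 1 ⊗ D^C` makes the
charge conjugation parallel, i.e. `v(C(φ, ψ)) = C(D_v φ, ψ) + C(φ, D^C_v ψ)`. -/
def conj (D : SpinorConnection 𝕜 E F S) : CovariantDerivative 𝓘(ℝ, E) F S where
  toFun ψ x := if hψ : MDiffAt (T% ψ) x then (C.exists_conj D hψ).choose else 0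
  isCovariantDerivativeOnUniv :=
    { add := fun {ψ ψ' x} hψ hψ' _ ↦ by
        have hadd : MDiffAt (T% (ψ + ψ')) x := mdifferentiableAt_add_section hψ hψ'
        rw [dif_pos hψ, dif_pos hψ', dif_pos hadd]
        ext v
        refine C.ext_right fun φ ↦ ?_
        have h0 := FiberBundle.mdifferentiableAt_extend 𝓘(ℝ, E) F φ
        have h1 := (C.exists_conj D hψ).choose_spec _ h0 v
        have h2 := (C.exists_conj D hψ').choose_spec _ h0 v
        have h3 := (C.exists_conj D hadd).choose_spec _ h0 v
        have h4 := mvfderiv_add (C.mdifferentiableAt_form h0 hψ) (C.mdifferentiableAt_form h0 hψ')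
        have h5 : (fun y ↦ C.form y (FiberBundle.extend F φ y) ((ψ + ψ') y))
            = (fun y ↦ C.form y (FiberBundle.extend F φ y) (ψ y))
              + (fun y ↦ C.form y (FiberBundle.extend F φ y) (ψ' y)) := by
          ext y; simp
        rw [h5, h4] at h3
        simp only [add_apply, Pi.add_apply, map_add,
          FiberBundle.extend_apply_self] at h1 h2 h3 ⊢
        rw [h1, h2] at h3
        linear_combination -h3
      leibniz := fun {ψ f x} hψ hf _ ↦ by
        have hsm : MDiffAt (T% (f • ψ)) x := hf.smul_section hψ
        rw [dif_pos hψ, dif_pos hsm]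
        ext v
        refine C.ext_right fun φ ↦ ?_
        have h0 := FiberBundle.mdifferentiableAt_extend 𝓘(ℝ, E) F φ
        have h1 := (C.exists_conj D hψ).choose_spec _ h0 v
        have h3 := (C.exists_conj D hsm).choose_spec _ h0 v
        have h4 := mvfderiv_smul hf (C.mdifferentiableAt_form h0 hψ)
        have h5 : (fun y ↦ C.form y (FiberBundle.extend F φ y) ((f • ψ) y))
            = f • (fun y ↦ C.form y (FiberBundle.extend F φ y) (ψ y)) := by
          ext y; simp
        rw [h5, h4] at h3
        simp only [add_apply, smul_apply,
          ContinuousLinearMap.smulRight_apply, Pi.smul_apply', map_add, map_smul, h1,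
          FiberBundle.extend_apply_self, smul_add] at h1 h3 ⊢
        linear_combination -h3 }

theorem mvfderiv_form (D : SpinorConnection 𝕜 E F S) {φ ψ : Π x : M, S x} {x : M}
    (hφ : MDiffAt (T% φ) x) (hψ : MDiffAt (T% ψ) x) (v : TangentSpace 𝓘(ℝ, E) x) :
    mvfderiv 𝓘(ℝ, E) (fun y ↦ C.form y (φ y) (ψ y)) x v
      = C.form x (D.toFun φ x v) (ψ x) + C.form x (φ x) (C.conj D ψ x v) := by
  have h := (C.exists_conj D hψ).choose_spec φ hφ v
  have h2 : C.conj D ψ x = (C.exists_conj D hψ).choose := dif_pos hψ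
  rw [h, h2]

end ChargeConjugation

section Tensors

variable {g : PseudoRiemannianMetric E M} {γ : CliffordMultiplication 𝕜 g F S}

/-- The curvature `R(v, w) s = D_v D_w s - D_w D_v s - D_{[v, w]} s` of `D`, computed with the
local smooth extensions of `v`, `w`, `s` which are constant in a trivialization (as `R` is
tensorial, every choice of smooth extensions gives the same value). -/
def curvature (D : SpinorConnection 𝕜 E F S) (x : M) (v w : TangentSpace 𝓘(ℝ, E) x) (s : S x) :
    S x :=
  D.toFun (fun y ↦ D.toFun (FiberBundle.extend F s) y (FiberBundle.extend E w y)) x v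
    - D.toFun (fun y ↦ D.toFun (FiberBundle.extend F s) y (FiberBundle.extend E v y)) x w
    - D.toFun (FiberBundle.extend F s) x
        (VectorField.mlieBracket 𝓘(ℝ, E) (FiberBundle.extend E v) (FiberBundle.extend E w) x)

variable (C : ChargeConjugation γ) (D : SpinorConnection 𝕜 E F S)
  (nabla : CovariantDerivative 𝓘(ℝ, E) E (TangentSpace 𝓘(ℝ, E) : M → Type _))

/-- The derivative of the Clifford multiplication in the connection induced by `D`, `D^C` and the
Levi-Civita connection: `(D̂_v γ)(w) s = D_v (γ(w) s) - γ(∇_v w) s - γ(w) D^C_v s`. It is tensorial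
in `w` and `s`, which are extended to sections that are constant in a trivialization. -/
def hatD (x : M) (v w : TangentSpace 𝓘(ℝ, E) x) (s : S x) : S x :=
  D.toFun (fun y ↦ γ.mul y (FiberBundle.extend E w y) (FiberBundle.extend F s y)) x v
    - γ.mul x (nabla (FiberBundle.extend E w) x v) s
    - γ.mul x w (C.conj D (FiberBundle.extend F s) x v)

/-- The torsion of the spinor connection `D`: twice the skew symmetrization of `D̂γ`. -/
def torsion (x : M) (v w : TangentSpace 𝓘(ℝ, E) x) (s : S x) : S x :=
  hatD C D nabla x v w s - hatD C D nabla x w v s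

/-- `(D, K)` is admissible: the symmetric part of `D̂γ` acts trivially on the spinors in `K`. -/
def IsAdmissible (K : Set (Π x : M, S x)) : Prop :=
  ∀ ξ ∈ K, ∀ (x : M) (v w : TangentSpace 𝓘(ℝ, E) x),
    hatD C D nabla x v w (ξ x) + hatD C D nabla x w v (ξ x) = 0

variable (γ) in
/-- The field `𝔅(R; φ, ψ) = γ^μ φ ∧ γ^ν ψ ∧ R_{μν}`, where the endomorphism `R_{μν}` of `S` acts on
spinors: at every point a map from `S` to `Λ³S`. -/
def fieldB (φ ψ : Π x : M, S x) (x : M) (s : S x) : ExteriorAlgebra 𝕜 (S x) :=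
  g.contract x fun eμ e_μ ↦ g.contract x fun eν e_ν ↦
    ExteriorAlgebra.ι 𝕜 (γ.mul x eμ (φ x)) * ExteriorAlgebra.ι 𝕜 (γ.mul x eν (ψ x))
      * ExteriorAlgebra.ι 𝕜 (curvature D x e_μ e_ν s)

/-- The field
`𝔇(𝒯; φ, ψ) = (γ^μ φ ∧ 𝒯_{μν} ψ + γ^μ ψ ∧ 𝒯_{μν} φ) ⊗ e^ν`, a section of `ΛS ⊗ TM`. -/
def fieldD (φ ψ : Π x : M, S x) (x : M) :
    ExteriorAlgebra 𝕜 (S x) ⊗[ℝ] TangentSpace 𝓘(ℝ, E) x :=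
  g.contract x fun eν e_ν ↦
    (g.contract x fun eμ e_μ ↦
      ExteriorAlgebra.ι 𝕜 (γ.mul x eμ (φ x))
          * ExteriorAlgebra.ι 𝕜 (torsion C D nabla x e_μ e_ν (ψ x))
        + ExteriorAlgebra.ι 𝕜 (γ.mul x eμ (ψ x))
          * ExteriorAlgebra.ι 𝕜 (torsion C D nabla x e_μ e_ν (φ x))) ⊗ₜ[ℝ] eν

/-- `(D, K)` is flat: `𝔅(R; φ, ψ) = 𝔇(𝒯; φ, ψ) = 0` for all `φ, ψ ∈ K`. -/
def IsFlat (K : Set (Π x : M, S x)) : Prop :=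
  ∀ φ ∈ K, ∀ ψ ∈ K, (∀ x s, fieldB γ D φ ψ x s = 0) ∧ (∀ x, fieldD C D nabla φ ψ x = 0)

end Tensors

section GradedManifold

variable (𝕜 E F S) in
/-- The (super)functions `f ∈ C^∞(M)` and `ψ ∈ ΓS`, as sections of `ΛS`. -/
def generators : Set (Π x : M, ExteriorAlgebra 𝕜 (S x)) :=
  {α | ∃ f : M → 𝕜, ContMDiff 𝓘(ℝ, E) 𝓘(ℝ, 𝕜) ∞ f ∧
      α = fun x ↦ algebraMap 𝕜 (ExteriorAlgebra 𝕜 (S x)) (f x)} ∪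
    {α | ∃ ψ : Π x : M, S x, ContMDiff 𝓘(ℝ, E) (𝓘(ℝ, E).prod 𝓘(ℝ, F)) ∞ (T% ψ) ∧
      α = fun x ↦ ExteriorAlgebra.ι 𝕜 (ψ x)}

variable (𝕜 E F S) in
/-- The algebra `ΓΛS` of smooth sections of `ΛS`, i.e. of functions on the graded manifold
`(M, ΓΛS)`: those families of elements of the exterior algebras `Λ(S x)` which, near every point,
are sums of products of smooth functions and smooth sections of `S`. -/
def SuperFunctions : Subalgebra 𝕜 (Π x : M, ExteriorAlgebra 𝕜 (S x)) where
  carrier := {α | ∀ x, ∃ α' ∈ Algebra.adjoin 𝕜 (generators 𝕜 E F S),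
    ∀ᶠ y in 𝓝 x, α y = α' y}
  mul_mem' {α β} hα hβ x := by
    obtain ⟨α', h1, h2⟩ := hα x
    obtain ⟨β', h3, h4⟩ := hβ x
    refine ⟨α' * β', mul_mem h1 h3, ?_⟩
    filter_upwards [h2, h4] with y hy hy'
    simp [hy, hy']
  add_mem' {α β} hα hβ x := by
    obtain ⟨α', h1, h2⟩ := hα x
    obtain ⟨β', h3, h4⟩ := hβ x
    refine ⟨α' + β', add_mem h1 h3, ?_⟩
    filter_upwards [h2, h4] with y hy hy'
    simp [hy, hy']
  algebraMap_mem' c x :=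
    ⟨_, Subalgebra.algebraMap_mem _ c, Filter.Eventually.of_forall fun _ ↦ rfl⟩

theorem mem_superFunctions_of_mem {α : Π x : M, ExteriorAlgebra 𝕜 (S x)}
    (h : α ∈ generators 𝕜 E F S) : α ∈ SuperFunctions 𝕜 E F S :=
  fun _ ↦ ⟨α, Algebra.subset_adjoin h, Filter.Eventually.of_forall fun _ ↦ rfl⟩

/-- A smooth function on `M` as a function on the graded manifold. -/
def ofFunction (f : M → 𝕜) (hf : ContMDiff 𝓘(ℝ, E) 𝓘(ℝ, 𝕜) ∞ f) : SuperFunctions 𝕜 E F S :=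
  ⟨fun x ↦ algebraMap 𝕜 (ExteriorAlgebra 𝕜 (S x)) (f x),
    mem_superFunctions_of_mem (Or.inl ⟨f, hf, rfl⟩)⟩

/-- A spinor field as an odd function on the graded manifold. -/
def ofSpinor (ψ : Π x : M, S x) (hψ : ContMDiff 𝓘(ℝ, E) (𝓘(ℝ, E).prod 𝓘(ℝ, F)) ∞ (T% ψ)) :
    SuperFunctions 𝕜 E F S :=
  ⟨fun x ↦ ExteriorAlgebra.ι 𝕜 (ψ x), mem_superFunctions_of_mem (Or.inr ⟨ψ, hψ, rfl⟩)⟩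

/-- The grading involution of `Λ(S x)`: the identity on even and minus the identity on odd
elements. -/
def parity (x : M) : ExteriorAlgebra 𝕜 (S x) →ₐ[𝕜] ExteriorAlgebra 𝕜 (S x) :=
  CliffordAlgebra.involute

variable (𝕜 E F S) in
/-- The odd vector fields on the graded manifold `(M, ΓΛS)`: the odd superderivations of `ΓΛS`,
i.e. the linear maps exchanging even and odd functions for which
`Q(αβ) = Q(α) β + (-1)^{|α|} α Q(β)`. -/
structure OddVectorField extends SuperFunctions 𝕜 E F S →ₗ[𝕜] SuperFunctions 𝕜 E F S where
  odd_of_even (α : SuperFunctions 𝕜 E F S) (hα : ∀ x, parity x (α.1 x) = α.1 x) (x : M) :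
    parity x ((toFun α).1 x) = -(toFun α).1 x
  even_of_odd (α : SuperFunctions 𝕜 E F S) (hα : ∀ x, parity x (α.1 x) = -α.1 x) (x : M) :
    parity x ((toFun α).1 x) = (toFun α).1 x
  leibniz (α β : SuperFunctions 𝕜 E F S) (x : M) :
    (toFun (α * β)).1 x = (toFun α).1 x * β.1 x + parity x (α.1 x) * (toFun β).1 x

variable {g : PseudoRiemannianMetric E M}

/-- `Q` is the odd vector field `ı(η) = γ^μ η ⊗ ȷ_D(e_μ)`. Here `ȷ_D(X)` is the derivation of `ΓΛS`
which acts on functions as `X` and on spinors as `D_X`, so that `ı(η)` is the odd derivation with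
`ı(η) f = df(e_μ) γ^μ η` and `ı(η) ψ = γ^μ η ∧ D_μ ψ`. -/
def IsImath (γ : CliffordMultiplication 𝕜 g F S) (D : SpinorConnection 𝕜 E F S)
    (η : Π x : M, S x) (Q : OddVectorField 𝕜 E F S) : Prop :=
  (∀ (f : M → 𝕜) (hf : ContMDiff 𝓘(ℝ, E) 𝓘(ℝ, 𝕜) ∞ f) (x : M),
    (Q.toFun (ofFunction f hf)).1 x = g.contract x fun eμ e_μ ↦
      mvfderiv 𝓘(ℝ, E) f x e_μ • ExteriorAlgebra.ι 𝕜 (γ.mul x eμ (η x))) ∧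
  (∀ (ψ : Π x : M, S x) (hψ : ContMDiff 𝓘(ℝ, E) (𝓘(ℝ, E).prod 𝓘(ℝ, F)) ∞ (T% ψ)) (x : M),
    (Q.toFun (ofSpinor ψ hψ)).1 x = g.contract x fun eμ e_μ ↦
      ExteriorAlgebra.ι 𝕜 (γ.mul x eμ (η x)) * ExteriorAlgebra.ι 𝕜 (D.toFun ψ x e_μ))

/-- An odd vector field is a differential if it squares to zero. -/
def OddVectorField.IsDifferential (Q : OddVectorField 𝕜 E F S) : Prop :=
  ∀ α, Q.toFun (Q.toFun α) = 0

end GradedManifold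

end Spinors

end SpinSuper

end

open SpinSuper

/-!
An odd superderivation of `ΓΛS` is determined by its values on functions and on spinor fields, which
generate `ΓΛS` locally. Conversely `D` extends at every point to a derivation of the exterior
algebra, and contracting it with `γ η` gives `ı(η)`.

The square of an odd superderivation is an even derivation, so `ı(η) ∘ ı(η) = 0` can be tested on
functions and spinor fields. Since `∇` is metric and torsion free and `D^C η = 0`, in a frame `e_μ`
`ı(η) ∘ ı(η) = (γ^ν η ∧ (D̂_ν γ)(e^μ) η) D_μ + ½ γ^μ η ∧ γ^ν η ∧ R_{μν}`,
where `R_{μν}` acts as a derivation killing functions. Admissibility gives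
`(D̂_ν γ)(e_μ) η = ½ 𝒯_{νμ} η`, so the coefficient of `D_μ` vanishes exactly when `𝔇(𝒯; η, η)` does;
this is detected by functions with prescribed differential at a point. On spinor fields the
remaining term is `½ 𝔅(R; η, η)`.
-/

noncomputable section

namespace SpinSuper

section Calculus

variable {E : Type*} [NormedAddCommGroup E] [NormedSpace ℝ E]
  {M : Type*} [TopologicalSpace M] [ChartedSpace E M]
  {W W' W'' : Type*} [NormedAddCommGroup W] [NormedSpace ℝ W] [NormedAddCommGroup W']
  [NormedSpace ℝ W'] [NormedAddCommGroup W''] [NormedSpace ℝ W'']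

theorem two_le_infty : (2 : ℕ∞ω) ≤ ∞ :=
  WithTop.coe_le_coe.2 le_top

theorem mvfderiv_congr {f f' : M → W} {x : M} (h : f =ᶠ[𝓝 x] f') : d% f x = d% f' x := by
  ext v
  exact DFunLike.congr_fun h.mfderiv_eq v

theorem mvfderiv_clm_comp (L : W →L[ℝ] W') {f : M → W} {x : M} (hf : MDiffAt f x)
    (v : TangentSpace 𝓘(ℝ, E) x) : d% (fun y ↦ L (f y)) x v = L (d% f x v) :=
  DFunLike.congr_fun (L.hasMFDerivAt.comp x hf.hasMFDerivAt).mfderiv v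

theorem hasMFDerivAt_bilinear (B : W →L[ℝ] W' →L[ℝ] W'') {f : M → W} {h : M → W'} {x : M}
    (hf : MDiffAt f x) (hh : MDiffAt h x) :
    HasMFDerivAt 𝓘(ℝ, E) 𝓘(ℝ, W'') (fun y ↦ B (f y) (h y)) x
      ((B.deriv₂ (f x, h x)).comp ((d% f x).prod (d% h x))) :=
  (B.isBoundedBilinearMap.hasFDerivAt (f x, h x)).hasMFDerivAt.comp x
    (HasMFDerivAt.prodMk hf.hasMFDerivAt hh.hasMFDerivAt)

theorem mvfderiv_bilinear (B : W →L[ℝ] W' →L[ℝ] W'') {f : M → W} {h : M → W'} {x : M}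
    (hf : MDiffAt f x) (hh : MDiffAt h x) (v : TangentSpace 𝓘(ℝ, E) x) :
    d% (fun y ↦ B (f y) (h y)) x v = B (d% f x v) (h x) + B (f x) (d% h x v) :=
  (DFunLike.congr_fun (hasMFDerivAt_bilinear B hf hh).mfderiv v).trans (add_comm _ _)

variable [IsManifold 𝓘(ℝ, E) ∞ M]

theorem contMDiff_mvfderiv_apply {f : M → W} (hf : CMDiff ∞ f)
    {V : Π y : M, TangentSpace 𝓘(ℝ, E) y} (hV : CMDiff ∞ (T% V)) :
    CMDiff ∞ fun y ↦ d% f y (V y) :=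
  (contMDiff_snd_tangentBundle_modelSpace W 𝓘(ℝ, W)).comp
    ((hf.contMDiff_tangentMap le_rfl).comp hV)

theorem contMDiffAt_extChartAt_symm {x : M} {z : E} (hz : z ∈ (extChartAt 𝓘(ℝ, E) x).target) :
    CMDiffAt ∞ (extChartAt 𝓘(ℝ, E) x).symm z :=
  (contMDiffOn_extChartAt_symm x).contMDiffAt ((isOpen_extChartAt_target x).mem_nhds hz)

theorem isInvertible_mfderiv_extChartAt_symm {x : M} {z : E}
    (hz : z ∈ (extChartAt 𝓘(ℝ, E) x).target) :
    (mfderiv% (extChartAt 𝓘(ℝ, E) x).symm z).IsInvertible := by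
  simpa using isInvertible_mfderivWithin_extChartAt_symm (I := 𝓘(ℝ, E)) hz

theorem fderiv_comp_extChartAt_symm {f : M → W} {x : M} {z : E}
    (hz : z ∈ (extChartAt 𝓘(ℝ, E) x).target) (hf : MDiffAt f ((extChartAt 𝓘(ℝ, E) x).symm z))
    (V : Π y : M, TangentSpace 𝓘(ℝ, E) y) :
    fderiv ℝ (f ∘ (extChartAt 𝓘(ℝ, E) x).symm) z
        (VectorField.mpullback 𝓘(ℝ, E) 𝓘(ℝ, E) (extChartAt 𝓘(ℝ, E) x).symm V z)
      = d% f ((extChartAt 𝓘(ℝ, E) x).symm z) (V ((extChartAt 𝓘(ℝ, E) x).symm z)) := by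
  have hcomp := mfderiv_comp z hf ((contMDiffAt_extChartAt_symm hz).mdifferentiableAt (by simp))
  rw [mfderiv_eq_fderiv] at hcomp
  refine (DFunLike.congr_fun hcomp _).trans (congrArg (d% f _) ?_)
  exact (isInvertible_mfderiv_extChartAt_symm hz).self_apply_inverse _

theorem differentiableAt_mpullback_extChartAt_symm [CompleteSpace E] {x : M}
    {V : Π y : M, TangentSpace 𝓘(ℝ, E) y} (hV : MDiffAt (T% V) x) :
    DifferentiableAt ℝ (VectorField.mpullback 𝓘(ℝ, E) 𝓘(ℝ, E) (extChartAt 𝓘(ℝ, E) x).symm V)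
      (extChartAt 𝓘(ℝ, E) x x) := by
  have := hV.mdifferentiableWithinAt (s := Set.univ)
    |>.differentiableWithinAt_mpullbackWithin_vectorField
  simp only [modelWithCornersSelf_coe, Set.range_id, VectorField.mpullbackWithin_univ,
    Set.preimage_univ, Set.inter_univ] at this
  exact differentiableWithinAt_univ.1 this

theorem mvfderiv_mlieBracket [CompleteSpace E] {f : M → W} (hf : CMDiff ∞ f)
    {V V' : Π y : M, TangentSpace 𝓘(ℝ, E) y} (hV : CMDiff ∞ (T% V)) (hV' : CMDiff ∞ (T% V'))
    (x : M) :
    d% f x (VectorField.mlieBracket 𝓘(ℝ, E) V V' x)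
      = d% (fun y ↦ d% f y (V' y)) x (V x) - d% (fun y ↦ d% f y (V y)) x (V' x) := by
  have hsmooth : minSmoothness ℝ 2 ≤ ∞ := by simpa using two_le_infty
  have : IsManifold 𝓘(ℝ, E) (minSmoothness ℝ 2) M := .of_le hsmooth
  set φ := extChartAt 𝓘(ℝ, E) x
  have hz : φ x ∈ φ.target := mem_extChartAt_target x
  have hφx : φ.symm (φ x) = x := extChartAt_to_inv x
  let P : (Π y : M, TangentSpace 𝓘(ℝ, E) y) → E → E := VectorField.mpullback 𝓘(ℝ, E) 𝓘(ℝ, E) φ.symm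
  have hφ : CMDiffAt ∞ φ.symm (φ x) := contMDiffAt_extChartAt_symm hz
  have hP {V : Π y : M, TangentSpace 𝓘(ℝ, E) y} (hV : CMDiff ∞ (T% V)) :
      DifferentiableAt ℝ (P V) (φ x) :=
    differentiableAt_mpullback_extChartAt_symm (hV.mdifferentiable (by simp) x)
  have iterated {V V' : Π y : M, TangentSpace 𝓘(ℝ, E) y} (hV' : CMDiff ∞ (T% V')) :
      d% (fun y ↦ d% f y (V' y)) x (V x)
        = fderiv ℝ (fun z ↦ fderiv ℝ (f ∘ φ.symm) z (P V' z)) (φ x) (P V (φ x)) := by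
    have hd := (contMDiff_mvfderiv_apply hf hV').mdifferentiable (by simp)
    have hout := fderiv_comp_extChartAt_symm hz (hd _) V
    rw [hφx] at hout
    rw [← hout]
    refine congrArg (fun L : E →L[ℝ] W ↦ L (P V (φ x))) (Filter.EventuallyEq.fderiv_eq ?_)
    filter_upwards [(isOpen_extChartAt_target x).mem_nhds hz] with z hz
    exact (fderiv_comp_extChartAt_symm hz (hf.mdifferentiable (by simp) _) V').symm
  have bracket : P (VectorField.mlieBracket 𝓘(ℝ, E) V V') (φ x)
      = VectorField.lieBracket ℝ (P V) (P V') (φ x) := by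
    rw [← VectorField.lieBracketWithin_univ, ← VectorField.mlieBracketWithin_eq_lieBracketWithin]
    exact VectorField.mpullback_mlieBracket (hV.mdifferentiable (by simp) _)
      (hV'.mdifferentiable (by simp) _) hφ hsmooth
  have hread := fderiv_comp_extChartAt_symm hz (hf.mdifferentiable (by simp) _)
    (VectorField.mlieBracket 𝓘(ℝ, E) V V')
  rw [hφx] at hread
  rw [← hread, iterated hV', iterated hV, ← VectorField.fderiv_apply_lieBracket
    (hf.contMDiffAt.comp _ hφ).contDiffAt hsmooth (hP hV') (hP hV)]
  exact congrArg _ bracket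

variable [FiniteDimensional ℝ E] [T2Space M]

theorem exists_smooth_cutoff {x : M} {u : Set M} (hu : u ∈ 𝓝 x) :
    ∃ ρ : M → ℝ, CMDiff ∞ ρ ∧ ρ =ᶠ[𝓝 x] 1 ∧ tsupport ρ ⊆ u := by
  obtain ⟨ρ, -, hρ⟩ := (SmoothBumpFunction.nhds_basis_tsupport (I := 𝓘(ℝ, E)) x).mem_iff.1 hu
  exact ⟨ρ, ρ.contMDiff, ρ.eventuallyEq_one, hρ⟩

theorem exists_contMDiff_mvfderiv_eq (x : M) (ℓ : TangentSpace 𝓘(ℝ, E) x →L[ℝ] ℝ) :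
    ∃ f : M → ℝ, CMDiff ∞ f ∧ d% f x = ℓ := by
  have hx : x ∈ (chartAt E x).source := mem_chart_source E x
  obtain ⟨L, hL⟩ := isInvertible_mfderiv_extChartAt (I := 𝓘(ℝ, E)) (mem_extChartAt_source x)
  let ℓ' : E →L[ℝ] ℝ := ℓ.comp L.symm.toContinuousLinearMap
  obtain ⟨ρ⟩ : Nonempty (SmoothBumpFunction 𝓘(ℝ, E) x) := inferInstance
  refine ⟨fun y ↦ ρ y • ℓ' (extChartAt 𝓘(ℝ, E) x y),
    ρ.contMDiff_smul (ℓ'.contMDiff.comp_contMDiffOn contMDiffOn_extChartAt), ?_⟩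
  have hgerm : (fun y ↦ ρ y • ℓ' (extChartAt 𝓘(ℝ, E) x y))
      =ᶠ[𝓝 x] fun y ↦ ℓ' (extChartAt 𝓘(ℝ, E) x y) := by
    filter_upwards [ρ.eventuallyEq_one] with y hy
    simp [hy]
  ext v
  rw [mvfderiv_congr hgerm, mvfderiv_clm_comp ℓ' (mdifferentiableAt_extChartAt hx)]
  exact congrArg ℓ ((DFunLike.congr_arg L.symm (DFunLike.congr_fun hL v).symm).trans
    (L.symm_apply_apply v))

variable {F : Type*} [NormedAddCommGroup F] [NormedSpace ℝ F]
  {S : M → Type*} [TopologicalSpace (TotalSpace F S)] [∀ x, AddCommGroup (S x)]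
  [∀ x, Module ℝ (S x)] [∀ x, TopologicalSpace (S x)] [FiberBundle F S] [VectorBundle ℝ F S]

theorem exists_contMDiff_section_eventuallyEq {x : M} {σ : Π y : M, S y}
    (h : ∀ᶠ y in 𝓝 x, CMDiffAt ∞ (T% σ) y) :
    ∃ ψ : Π y : M, S y, CMDiff ∞ (T% ψ) ∧ ∀ᶠ y in 𝓝 x, ψ y = σ y := by
  obtain ⟨u, hu, hou, hxu⟩ := eventually_nhds_iff.1 h
  obtain ⟨ρ, hρ, hρx, hsupp⟩ := exists_smooth_cutoff (E := E) (hou.mem_nhds hxu)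
  refine ⟨ρ • σ, ContMDiffOn.smul_section_of_tsupport hρ.contMDiffOn hou hsupp
    fun y hy ↦ (hu y hy).contMDiffWithinAt, ?_⟩
  filter_upwards [hρx] with y hy
  simp [hy]

theorem exists_contMDiff_eventuallyEq_extend [ContMDiffVectorBundle ∞ F S 𝓘(ℝ, E)] {x : M}
    (s : S x) :
    ∃ ψ : Π y : M, S y, CMDiff ∞ (T% ψ) ∧ ∀ᶠ y in 𝓝 x, ψ y = FiberBundle.extend F s y := by
  obtain ⟨u, hu, hsmooth⟩ := FiberBundle.exists_contMDiffOn_extend (k := ∞) 𝓘(ℝ, E) F s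
  refine exists_contMDiff_section_eventuallyEq ?_
  filter_upwards [eventually_mem_nhds_iff.2 hu] with y hy
  exact hsmooth.contMDiffAt hy

theorem exists_contMDiff_section_apply_eq [ContMDiffVectorBundle ∞ F S 𝓘(ℝ, E)] {x : M}
    (s : S x) : ∃ ψ : Π y : M, S y, CMDiff ∞ (T% ψ) ∧ ψ x = s := by
  obtain ⟨ψ, hψ, h⟩ := exists_contMDiff_eventuallyEq_extend (E := E) (F := F) s
  exact ⟨ψ, hψ, by rw [h.self_of_nhds, FiberBundle.extend_apply_self]⟩

end Calculus

/-! ### Dual frames -/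

section Matrix

variable {E : Type*} [NormedAddCommGroup E] [NormedSpace ℝ E]
  {M : Type*} [TopologicalSpace M] [ChartedSpace E M]
  {ι : Type*} [Fintype ι] [DecidableEq ι] {k : ℕ∞ω} {x : M} {A : M → Matrix ι ι ℝ}

theorem contMDiffAt_matrix_det (hA : ∀ i j, CMDiffAt k (fun y ↦ A y i j) x) :
    CMDiffAt k (fun y ↦ (A y).det) x := by
  simp only [Matrix.det_apply']
  exact contMDiffAt_finsetSum fun σ _ ↦
    contMDiffAt_const.mul (contMDiffAt_finsetProd fun i _ ↦ hA _ _)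

theorem contMDiffAt_matrix_inv (hA : ∀ i j, CMDiffAt k (fun y ↦ A y i j) x)
    (hx : (A x).det ≠ 0) (i j : ι) : CMDiffAt k (fun y ↦ (A y)⁻¹ i j) x := by
  have hadj : CMDiffAt k (fun y ↦ (A y).adjugate i j) x := by
    simp only [Matrix.adjugate_apply]
    refine contMDiffAt_matrix_det fun i' j' ↦ ?_
    by_cases hj : i' = j
    · subst hj
      simpa using contMDiffAt_const
    · simpa [Matrix.updateRow_ne hj] using hA i' j'
  simp only [Matrix.inv_def, Ring.inverse_eq_inv, Matrix.smul_apply, smul_eq_mul]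
  exact ((contMDiffAt_matrix_det hA).inv₀ hx).mul hadj

end Matrix

namespace PseudoRiemannianMetric

variable {E : Type*} [NormedAddCommGroup E] [NormedSpace ℝ E]
  {M : Type*} [TopologicalSpace M] [ChartedSpace E M] [IsManifold 𝓘(ℝ, E) ∞ M]
  (g : PseudoRiemannianMetric E M)

theorem contMDiff_val {X Y : Π y : M, TangentSpace 𝓘(ℝ, E) y}
    (hX : CMDiff ∞ (T% X)) (hY : CMDiff ∞ (T% Y)) : CMDiff ∞ fun y ↦ g.val y (X y) (Y y) := by
  intro x
  have : ContMDiffAt 𝓘(ℝ, E) (𝓘(ℝ, E).prod 𝓘(ℝ, ℝ)) ∞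
      (fun y ↦ TotalSpace.mk' ℝ (E := Bundle.Trivial M ℝ) y (g.val y (X y) (Y y))) x :=
    ContMDiffAt.clm_bundle_apply₂ (F₁ := E) (F₂ := E) g.contMDiff.contMDiffAt (hX x) (hY x)
  exact (contMDiffAt_totalSpace.1 this).2

/-- `e'` is the frame dual to `e` with respect to `g`; then `e` is automatically a basis of
`T_x M`, by dimension. -/
def IsDualFrame {x : M} (e' e : Fin (Module.finrank ℝ E) → TangentSpace 𝓘(ℝ, E) x) : Prop :=
  ∀ μ ν, g.val x (e' μ) (e ν) = if μ = ν then 1 else 0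

variable {g} {x : M} {e e' : Fin (Module.finrank ℝ E) → TangentSpace 𝓘(ℝ, E) x}

theorem IsDualFrame.symm (h : g.IsDualFrame e' e) : g.IsDualFrame e e' := fun μ ν ↦ by
  rw [g.symm, h]
  simp [eq_comm]

variable [FiniteDimensional ℝ E]

theorem isDualFrame_coframe (g : PseudoRiemannianMetric E M) (x : M) :
    g.IsDualFrame (g.coframe x) (frame x) := fun μ ν ↦
  ((g.bilin x).apply_dualBasis_left (g.bilin_nondegenerate x) (frame x) μ ν).trans
    (by simp [eq_comm])

namespace IsDualFrame

theorem sum_val_smul (h : g.IsDualFrame e' e) (v : TangentSpace 𝓘(ℝ, E) x) :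
    ∑ μ, g.val x (e' μ) v • e μ = v := by
  have : FiniteDimensional ℝ (TangentSpace 𝓘(ℝ, E) x) := inferInstanceAs (FiniteDimensional ℝ E)
  have hli : LinearIndependent ℝ e := by
    rw [Fintype.linearIndependent_iff]
    intro c hc μ
    simpa [h μ] using congrArg (g.val x (e' μ)) hc
  have hcard : Fintype.card (Fin (Module.finrank ℝ E))
      = Module.finrank ℝ (TangentSpace 𝓘(ℝ, E) x) := Fintype.card_fin _
  let b := basisOfLinearIndependentOfCardEqFinrank' _ hli hcard
  have hb (μ) : b μ = e μ := by simp [b]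
  have hrepr (μ) : g.val x (e' μ) v = b.repr v μ := by
    conv_lhs => rw [← b.sum_repr v]
    simp [hb, h μ]
  simp only [hrepr, ← hb, b.sum_repr]

theorem contract_eq_sum (h : g.IsDualFrame e' e) {W : Type*} [AddCommGroup W] [Module ℝ W]
    (B : TangentSpace 𝓘(ℝ, E) x →ₗ[ℝ] TangentSpace 𝓘(ℝ, E) x →ₗ[ℝ] W) :
    g.contract x (fun v w ↦ B v w) = ∑ μ, B (e' μ) (e μ) :=
  calc g.contract x (fun v w ↦ B v w)
      = ∑ ν, B (g.coframe x ν) (∑ μ, g.val x (e' μ) (frame x ν) • e μ) := by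
        simp only [h.sum_val_smul]
        rfl
    _ = ∑ μ, B (∑ ν, g.val x (frame x ν) (e' μ) • g.coframe x ν) (e μ) := by
        simp only [map_sum, map_smul, LinearMap.sum_apply, LinearMap.smul_apply, g.symm x (e' _)]
        exact Finset.sum_comm
    _ = ∑ μ, B (e' μ) (e μ) := by simp only [(g.isDualFrame_coframe x).symm.sum_val_smul]

end IsDualFrame

theorem det_val_frame_ne_zero (g : PseudoRiemannianMetric E M) (x : M) :
    (Matrix.of fun μ ν ↦ g.val x (frame x μ) (frame x ν)).det ≠ 0 := by
  have hG : (Matrix.of fun μ ν ↦ g.val x (frame x μ) (frame x ν))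
      = LinearMap.BilinForm.toMatrix (frame x) (g.bilin x) := by
    ext μ ν
    simp only [Matrix.of_apply, LinearMap.BilinForm.toMatrix_apply]
    rfl
  rw [hG, ← LinearMap.BilinForm.nondegenerate_iff_det_ne_zero]
  exact g.bilin_nondegenerate x

theorem exists_dual_frame [T2Space M] (g : PseudoRiemannianMetric E M) (x : M) :
    ∃ e e' : Fin (Module.finrank ℝ E) → Π y : M, TangentSpace 𝓘(ℝ, E) y,
      (∀ μ, CMDiff ∞ (T% (e μ))) ∧ (∀ μ, CMDiff ∞ (T% (e' μ))) ∧
      (∀ μ, ∀ᶠ y in 𝓝 x, e μ y = FiberBundle.extend E (frame x μ) y) ∧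
      ∀ᶠ y in 𝓝 x, g.IsDualFrame (e' · y) (e · y) := by
  choose e he hext using fun μ ↦
    exists_contMDiff_eventuallyEq_extend (E := E) (F := E) (frame (E := E) x μ)
  let G : M → Matrix (Fin (Module.finrank ℝ E)) (Fin (Module.finrank ℝ E)) ℝ :=
    fun y ↦ Matrix.of fun μ ν ↦ g.val y (e μ y) (e ν y)
  have hG (y μ ν) : CMDiffAt ∞ (fun y ↦ G y μ ν) y := (g.contMDiff_val (he μ) (he ν)) y
  have hGx : (G x).det ≠ 0 := by
    have hex (μ) : e μ x = frame x μ := by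
      rw [(hext μ).self_of_nhds, FiberBundle.extend_apply_self]
    simpa only [G, hex] using g.det_val_frame_ne_zero x
  have hdet : ∀ᶠ y in 𝓝 x, (G y).det ≠ 0 :=
    (contMDiffAt_matrix_det (hG x)).continuousAt.eventually_ne hGx
  have hinv (μ) : ∃ V : Π y : M, TangentSpace 𝓘(ℝ, E) y, CMDiff ∞ (T% V) ∧
      ∀ᶠ y in 𝓝 x, V y = ∑ ν, (G y)⁻¹ μ ν • e ν y := by
    refine exists_contMDiff_section_eventuallyEq (F := E) ?_
    filter_upwards [hdet] with y hy
    exact ContMDiffAt.sum_section fun ν _ ↦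
      (contMDiffAt_matrix_inv (hG y) hy μ ν).smul_section (he ν y)
  choose e' he' hinv using hinv
  refine ⟨e, e', he, he', hext, ?_⟩
  filter_upwards [hdet, Filter.eventually_all.2 hinv] with y hy hy' μ ν
  have hmul : ((G y)⁻¹ * G y) μ ν = if μ = ν then 1 else 0 := by
    rw [Matrix.nonsing_inv_mul _ (Ne.isUnit hy), Matrix.one_apply]
  simp [← hmul, hy', Matrix.mul_apply, G]

end PseudoRiemannianMetric

/-! ### Curvature and derivative of the Clifford multiplication -/

section LocalSections

variable {E : Type*} [NormedAddCommGroup E] [NormedSpace ℝ E]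
  {M : Type*} [TopologicalSpace M] [ChartedSpace E M]
  {F : Type*} [NormedAddCommGroup F] [NormedSpace ℝ F]
  {S : M → Type*} [TopologicalSpace (TotalSpace F S)] [∀ x, AddCommGroup (S x)]
  [∀ x, Module ℝ (S x)] [∀ x, TopologicalSpace (S x)] [FiberBundle F S] [VectorBundle ℝ F S]

omit [∀ x, AddCommGroup (S x)] [∀ x, Module ℝ (S x)] [VectorBundle ℝ F S] in
theorem mdifferentiableAt_section_congr {x : M} {ψ ψ' : Π y : M, S y}
    (hψ : MDiffAt (T% ψ) x) (h : ∀ᶠ y in 𝓝 x, ψ' y = ψ y) : MDiffAt (T% ψ') x := by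
  refine hψ.congr_of_eventuallyEq ?_
  filter_upwards [h] with y hy
  rw [hy]

theorem exists_smooth_local_frame [IsManifold 𝓘(ℝ, E) ∞ M] [FiniteDimensional ℝ E] [T2Space M]
    [FiniteDimensional ℝ F] [ContMDiffVectorBundle ∞ F S 𝓘(ℝ, E)] (x : M) :
    ∃ (s : Fin (Module.finrank ℝ F) → Π y : M, S y) (a : Fin (Module.finrank ℝ F) → S x → ℝ),
      (∀ i, CMDiff ∞ (T% (s i))) ∧ ∀ ψ : Π y : M, S y, CMDiff ∞ (T% ψ) →
        ∃ c : Fin (Module.finrank ℝ F) → M → ℝ, (∀ i, CMDiff ∞ (c i)) ∧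
          (∀ i, c i x = a i (ψ x)) ∧ ∀ᶠ y in 𝓝 x, ψ y = ∑ i, c i y • s i y := by
  let t := trivializationAt F S x
  let b := Module.finBasis ℝ F
  have hnear : ∀ᶠ y in 𝓝 x, y ∈ t.baseSet :=
    t.open_baseSet.mem_nhds (FiberBundle.mem_baseSet_trivializationAt' x)
  have hframe (i) : ∃ s : Π y : M, S y, CMDiff ∞ (T% s) ∧ ∀ᶠ y in 𝓝 x, s y = t.localFrame b i y :=
    exists_contMDiff_section_eventuallyEq
      (hnear.mono fun y hy ↦ contMDiffAt_localFrame_of_mem ∞ t b i hy)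
  choose s hs hst using hframe
  obtain ⟨ρ, hρ, hρx, hsupp⟩ := exists_smooth_cutoff (E := E) hnear
  refine ⟨s, fun i ↦ t.localFrameCoeff 𝓘(ℝ, E) b i x, hs, fun ψ hψ ↦
    ⟨fun i y ↦ t.localFrameCoeff 𝓘(ℝ, E) b i y ((ρ • ψ) y), fun i y ↦ ?_, fun i ↦ ?_, ?_⟩⟩
  · by_cases hy : y ∈ tsupport ρ
    · exact contMDiffAt_localFrameCoeff b (hsupp hy) (hρ.smul_section hψ).contMDiffAt i
    · refine (contMDiffAt_const (c := 0)).congr_of_eventuallyEq ?_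
      filter_upwards [(isClosed_tsupport ρ).isOpen_compl.mem_nhds hy] with z hz
      simp [image_eq_zero_of_notMem_tsupport hz]
  · simp [hρx.self_of_nhds]
  · filter_upwards [hnear, Filter.eventually_all.2 hst, hρx] with y hy hsy hρy
    simp only [hsy, ← Trivialization.eq_sum_localFrameCoeff_smul (I := 𝓘(ℝ, E)) (b := b) hy
      (s := ρ • ψ)]
    simp [hρy]

end LocalSections

namespace SpinorConnection

variable {𝕜 : Type*} [RCLike 𝕜]
  {E : Type*} [NormedAddCommGroup E] [NormedSpace ℝ E]
  {M : Type*} [TopologicalSpace M] [ChartedSpace E M] [IsManifold 𝓘(ℝ, E) ∞ M]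
  {F : Type*} [NormedAddCommGroup F] [NormedSpace ℝ F]
  {S : M → Type*} [TopologicalSpace (TotalSpace F S)]
  [∀ x, AddCommGroup (S x)] [∀ x, Module ℝ (S x)] [∀ x, Module 𝕜 (S x)]
  [∀ x, TopologicalSpace (S x)]
  [∀ x, IsTopologicalAddGroup (S x)] [∀ x, ContinuousSMul ℝ (S x)]
  [FiberBundle F S] [VectorBundle ℝ F S] (D : SpinorConnection 𝕜 E F S)

theorem toFun_congr {x : M} {ψ ψ' : Π y : M, S y} (hψ : MDiffAt (T% ψ) x)
    (h : ∀ᶠ y in 𝓝 x, ψ' y = ψ y) : D.toFun ψ' x = D.toFun ψ x :=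
  D.isCovariantDerivativeOnUniv.congr_of_eventuallyEq (mdifferentiableAt_section_congr hψ h) hψ
    Filter.univ_mem h

theorem contMDiff_apply {ψ : Π y : M, S y} (hψ : CMDiff ∞ (T% ψ))
    {V : Π y : M, TangentSpace 𝓘(ℝ, E) y} (hV : CMDiff ∞ (T% V)) :
    CMDiff ∞ (T% fun y ↦ D.toFun ψ y (V y)) := by
  have hD := D.smooth.contMDiff.contMDiff (σ := ψ) (by simpa using hψ.contMDiffOn)
  rw [contMDiffOn_univ] at hD
  exact hD.clm_bundle_apply hV

/-- The curvature operator `D_V D_W - D_W D_V - D_{[V, W]}` of two vector fields. -/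
def curvatureOp (V W : Π y : M, TangentSpace 𝓘(ℝ, E) y) (ψ : Π y : M, S y) (x : M) : S x :=
  D.toFun (fun y ↦ D.toFun ψ y (W y)) x (V x) - D.toFun (fun y ↦ D.toFun ψ y (V y)) x (W x)
    - D.toFun ψ x (VectorField.mlieBracket 𝓘(ℝ, E) V W x)

variable {V W : Π y : M, TangentSpace 𝓘(ℝ, E) y} {ψ ψ' : Π y : M, S y} {x : M}

theorem curvatureOp_congr (hV : CMDiff ∞ (T% V)) (hW : CMDiff ∞ (T% W)) (hψ : CMDiff ∞ (T% ψ))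
    (h : ∀ᶠ y in 𝓝 x, ψ' y = ψ y) : D.curvatureOp V W ψ' x = D.curvatureOp V W ψ x := by
  have hfirst (U : Π y : M, TangentSpace 𝓘(ℝ, E) y) :
      ∀ᶠ y in 𝓝 x, D.toFun ψ' y (U y) = D.toFun ψ y (U y) := by
    filter_upwards [h.eventually_nhds] with y hy
    rw [D.toFun_congr (hψ.mdifferentiable (by simp) y) hy]
  rw [curvatureOp, curvatureOp,
    D.toFun_congr ((D.contMDiff_apply hψ hW).mdifferentiable (by simp) x) (hfirst W),
    D.toFun_congr ((D.contMDiff_apply hψ hV).mdifferentiable (by simp) x) (hfirst V),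
    D.toFun_congr (hψ.mdifferentiable (by simp) x) h]

theorem curvatureOp_add (hV : CMDiff ∞ (T% V)) (hW : CMDiff ∞ (T% W)) (hψ : CMDiff ∞ (T% ψ))
    (hψ' : CMDiff ∞ (T% ψ')) (x : M) :
    D.curvatureOp V W (ψ + ψ') x = D.curvatureOp V W ψ x + D.curvatureOp V W ψ' x := by
  have hfirst (y : M) : D.toFun (ψ + ψ') y = D.toFun ψ y + D.toFun ψ' y :=
    D.isCovariantDerivativeOnUniv.add (hψ.mdifferentiable (by simp) y)
      (hψ'.mdifferentiable (by simp) y)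
  have hsecond {U : Π y : M, TangentSpace 𝓘(ℝ, E) y} (hU : CMDiff ∞ (T% U)) :
      D.toFun (fun y ↦ D.toFun (ψ + ψ') y (U y)) x
        = D.toFun (fun y ↦ D.toFun ψ y (U y)) x + D.toFun (fun y ↦ D.toFun ψ' y (U y)) x := by
    simp only [hfirst, add_apply]
    exact D.isCovariantDerivativeOnUniv.add
      ((D.contMDiff_apply hψ hU).mdifferentiable (by simp) x)
      ((D.contMDiff_apply hψ' hU).mdifferentiable (by simp) x)
  unfold curvatureOp
  rw [hsecond hV, hsecond hW, hfirst]
  simp only [add_apply]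
  abel

theorem toFun_toFun_smul {U : Π y : M, TangentSpace 𝓘(ℝ, E) y} (hU : CMDiff ∞ (T% U))
    (hψ : CMDiff ∞ (T% ψ)) {c : M → ℝ} (hc : CMDiff ∞ c) (v : TangentSpace 𝓘(ℝ, E) x) :
    D.toFun (fun y ↦ D.toFun (c • ψ) y (U y)) x v
      = c x • D.toFun (fun y ↦ D.toFun ψ y (U y)) x v + d% c x v • D.toFun ψ x (U x)
        + (d% c x (U x) • D.toFun ψ x v + d% (fun y ↦ d% c y (U y)) x v • ψ x) := by
  have hcov := D.isCovariantDerivativeOnUniv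
  have hfirst : (fun y ↦ D.toFun (c • ψ) y (U y))
      = (c • fun y ↦ D.toFun ψ y (U y)) + (fun y ↦ d% c y (U y)) • ψ := by
    ext y
    simp [hcov.leibniz (hψ.mdifferentiable (by simp) y) (hc.mdifferentiable (by simp) y)]
  have hDψ := D.contMDiff_apply hψ hU
  have hdc := contMDiff_mvfderiv_apply hc hU
  rw [hfirst, hcov.add ((hc.smul_section hDψ).mdifferentiable (by simp) x)
    ((hdc.smul_section hψ).mdifferentiable (by simp) x),
    hcov.leibniz (hDψ.mdifferentiable (by simp) x) (hc.mdifferentiable (by simp) x),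
    hcov.leibniz (hψ.mdifferentiable (by simp) x) (hdc.mdifferentiable (by simp) x)]
  simp

theorem curvatureOp_smul [CompleteSpace E] (hV : CMDiff ∞ (T% V)) (hW : CMDiff ∞ (T% W))
    (hψ : CMDiff ∞ (T% ψ)) {c : M → ℝ} (hc : CMDiff ∞ c) (x : M) :
    D.curvatureOp V W (c • ψ) x = c x • D.curvatureOp V W ψ x := by
  have hfirst : D.toFun (c • ψ) x = c x • D.toFun ψ x + (d% c x).smulRight (ψ x) :=
    D.isCovariantDerivativeOnUniv.leibniz (hψ.mdifferentiable (by simp) x)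
      (hc.mdifferentiable (by simp) x)
  unfold curvatureOp
  rw [D.toFun_toFun_smul hV hψ hc, D.toFun_toFun_smul hW hψ hc, hfirst]
  simp only [add_apply, smul_apply, ContinuousLinearMap.smulRight_apply,
    mvfderiv_mlieBracket hc hV hW]
  module

theorem curvatureOp_sum [CompleteSpace E] (hV : CMDiff ∞ (T% V)) (hW : CMDiff ∞ (T% W))
    {ι : Type*} (t : Finset ι) {s : ι → Π y : M, S y} {c : ι → M → ℝ}
    (hs : ∀ i, CMDiff ∞ (T% (s i))) (hc : ∀ i, CMDiff ∞ (c i)) (x : M) :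
    D.curvatureOp V W (fun y ↦ ∑ i ∈ t, c i y • s i y) x
      = ∑ i ∈ t, c i x • D.curvatureOp V W (s i) x := by
  classical
  induction t using Finset.induction_on with
  | empty =>
    have hzero := D.curvatureOp_smul hV hW (ψ := fun y : M ↦ (0 : S y)) (c := fun _ ↦ 0)
      (contMDiff_zeroSection ℝ S) contMDiff_const x
    rw [zero_smul] at hzero
    simp only [Finset.sum_empty, ← hzero]
    congr 1
    ext y
    simp
  | insert i t hi ih =>
    simp only [Finset.sum_insert hi]
    rw [← ih, ← D.curvatureOp_smul hV hW (hs i) (hc i)]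
    exact D.curvatureOp_add hV hW ((hc i).smul_section (hs i))
      (.sum_section fun j _ ↦ (hc j).smul_section (hs j)) x

variable [ContMDiffVectorBundle ∞ F S 𝓘(ℝ, E)]
  [FiniteDimensional ℝ E] [T2Space M] [FiniteDimensional ℝ F]

theorem curvatureOp_eq_of_apply_eq (hV : CMDiff ∞ (T% V)) (hW : CMDiff ∞ (T% W))
    (hψ : CMDiff ∞ (T% ψ)) (hψ' : CMDiff ∞ (T% ψ')) (h : ψ x = ψ' x) :
    D.curvatureOp V W ψ x = D.curvatureOp V W ψ' x := by
  obtain ⟨s, a, hs, hcoeff⟩ := exists_smooth_local_frame (E := E) (F := F) (S := S) x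
  have hsum {ψ : Π y : M, S y} (hψ : CMDiff ∞ (T% ψ)) :
      D.curvatureOp V W ψ x = ∑ i, a i (ψ x) • D.curvatureOp V W (s i) x := by
    obtain ⟨c, hc, hcx, hψc⟩ := hcoeff ψ hψ
    rw [D.curvatureOp_congr hV hW (.sum_section (t := fun i y ↦ c i y • s i y)
      fun i _ ↦ (hc i).smul_section (hs i)) hψc,
      D.curvatureOp_sum hV hW _ hs hc]
    simp only [hcx]
  rw [hsum hψ, hsum hψ', h]

theorem curvatureOp_eq_curvature (hV : CMDiff ∞ (T% V)) (hW : CMDiff ∞ (T% W))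
    {v w : TangentSpace 𝓘(ℝ, E) x} (hVx : ∀ᶠ y in 𝓝 x, V y = FiberBundle.extend E v y)
    (hWx : ∀ᶠ y in 𝓝 x, W y = FiberBundle.extend E w y) (hψ : CMDiff ∞ (T% ψ)) :
    D.curvatureOp V W ψ x = curvature D x v w (ψ x) := by
  obtain ⟨ψ', hψ', hext⟩ := exists_contMDiff_eventuallyEq_extend (E := E) (F := F) (ψ x)
  have hval : ψ x = ψ' x := by rw [hext.self_of_nhds, FiberBundle.extend_apply_self]
  have hsecond {U : Π y : M, TangentSpace 𝓘(ℝ, E) y} {u : TangentSpace 𝓘(ℝ, E) x}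
      (hU : CMDiff ∞ (T% U)) (hUx : ∀ᶠ y in 𝓝 x, U y = FiberBundle.extend E u y) :
      D.toFun (fun y ↦ D.toFun (FiberBundle.extend F (ψ x)) y (FiberBundle.extend E u y)) x
        = D.toFun (fun y ↦ D.toFun ψ' y (U y)) x := by
    refine D.toFun_congr ((D.contMDiff_apply hψ' hU).mdifferentiable (by simp) x) ?_
    filter_upwards [hUx, hext.eventually_nhds] with y hy hy'
    rw [hy, D.toFun_congr (hψ'.mdifferentiable (by simp) y) (hy'.mono fun z hz ↦ hz.symm)]
  rw [D.curvatureOp_eq_of_apply_eq hV hW hψ hψ' hval, curvatureOp, curvature,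
    hsecond hV hVx, hsecond hW hWx, ← Filter.EventuallyEq.mlieBracket_vectorField_eq hVx hWx,
    D.toFun_congr (hψ'.mdifferentiable (by simp) x) (hext.mono fun z hz ↦ hz.symm)]
  simp only [hVx.self_of_nhds, hWx.self_of_nhds, FiberBundle.extend_apply_self]

end SpinorConnection

section HatD

variable {𝕜 : Type*} [RCLike 𝕜]
  {E : Type*} [NormedAddCommGroup E] [NormedSpace ℝ E] [FiniteDimensional ℝ E]
  {M : Type*} [TopologicalSpace M] [ChartedSpace E M] [IsManifold 𝓘(ℝ, E) ∞ M]
  {F : Type*} [NormedAddCommGroup F] [NormedSpace ℝ F]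
  {S : M → Type*} [TopologicalSpace (TotalSpace F S)]
  [∀ x, AddCommGroup (S x)] [∀ x, Module ℝ (S x)] [∀ x, Module 𝕜 (S x)]
  [∀ x, TopologicalSpace (S x)] [∀ x, IsTopologicalAddGroup (S x)] [∀ x, ContinuousSMul ℝ (S x)]
  [FiberBundle F S] [VectorBundle ℝ F S]
  {g : PseudoRiemannianMetric E M} {γ : CliffordMultiplication 𝕜 g F S}

namespace CliffordMultiplication

variable (γ)

theorem mdifferentiableAt_mul {W : Π y : M, TangentSpace 𝓘(ℝ, E) y} {ξ : Π y : M, S y} {x : M}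
    (hW : MDiffAt (T% W) x) (hξ : MDiffAt (T% ξ) x) :
    MDiffAt (T% fun y ↦ γ.mul y (W y) (ξ y)) x :=
  (γ.contMDiff.contMDiffAt.mdifferentiableAt (by simp)).clm_bundle_apply₂ (F₁ := E) (F₂ := F) hW hξ

theorem contMDiff_mul_apply {W : Π y : M, TangentSpace 𝓘(ℝ, E) y} {ξ : Π y : M, S y}
    (hW : CMDiff ∞ (T% W)) (hξ : CMDiff ∞ (T% ξ)) :
    CMDiff ∞ (T% fun y ↦ γ.mul y (W y) (ξ y)) := fun x ↦
  γ.contMDiff.contMDiffAt.clm_bundle_apply₂ (F₁ := E) (F₂ := F) (hW x) (hξ x)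

end CliffordMultiplication

variable [NormedSpace 𝕜 F] [IsScalarTower ℝ 𝕜 F] [FiniteDimensional ℝ F]
  [∀ x, IsScalarTower ℝ 𝕜 (S x)] [VectorBundle 𝕜 F S] [ContMDiffVectorBundle ∞ F S 𝓘(ℝ, E)]
  (C : ChargeConjugation γ) (D : SpinorConnection 𝕜 E F S)
  (nabla : CovariantDerivative 𝓘(ℝ, E) E (TangentSpace 𝓘(ℝ, E) : M → Type _))

/-- The operator `(W, ξ) ↦ D_v (Wξ) - (∇_v W) ξ - W D^C_v ξ` on a vector field and a spinor field,
whose value at `x` is `(D̂_v γ)(W) ξ` by tensoriality. -/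
def hatDOp (x : M) (v : TangentSpace 𝓘(ℝ, E) x) (W : Π y : M, TangentSpace 𝓘(ℝ, E) y)
    (ξ : Π y : M, S y) : S x :=
  D.toFun (fun y ↦ γ.mul y (W y) (ξ y)) x v - γ.mul x (nabla W x v) (ξ x)
    - γ.mul x (W x) (C.conj D ξ x v)

theorem tensorialAt_hatDOp_left (x : M) (v : TangentSpace 𝓘(ℝ, E) x) {ξ : Π y : M, S y}
    (hξ : MDiffAt (T% ξ) x) : TensorialAt 𝓘(ℝ, E) E (hatDOp C D nabla x v · ξ) x where
  smul {f W} hf hW := by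
    have hmul : (fun y ↦ γ.mul y ((f • W) y) (ξ y)) = f • fun y ↦ γ.mul y (W y) (ξ y) := by
      ext y; simp
    simp only [hatDOp, hmul, nabla.isCovariantDerivativeOnUniv.leibniz hW hf,
      D.isCovariantDerivativeOnUniv.leibniz (γ.mdifferentiableAt_mul hW hξ) hf]
    simp [smul_sub]
  add {W W'} hW hW' := by
    have hmul : (fun y ↦ γ.mul y ((W + W') y) (ξ y))
        = (fun y ↦ γ.mul y (W y) (ξ y)) + fun y ↦ γ.mul y (W' y) (ξ y) := by
      ext y; simp
    simp only [hatDOp, hmul, nabla.isCovariantDerivativeOnUniv.add hW hW',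
      D.isCovariantDerivativeOnUniv.add (γ.mdifferentiableAt_mul hW hξ)
        (γ.mdifferentiableAt_mul hW' hξ)]
    simp
    abel

theorem tensorialAt_hatDOp_right (x : M) (v : TangentSpace 𝓘(ℝ, E) x)
    {W : Π y : M, TangentSpace 𝓘(ℝ, E) y} (hW : MDiffAt (T% W) x) :
    TensorialAt 𝓘(ℝ, E) F (hatDOp C D nabla x v W ·) x where
  smul {f ξ} hf hξ := by
    have hmul : (fun y ↦ γ.mul y (W y) ((f • ξ) y)) = f • fun y ↦ γ.mul y (W y) (ξ y) := by
      ext y; simp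
    simp only [hatDOp, hmul, (C.conj D).isCovariantDerivativeOnUniv.leibniz hξ hf,
      D.isCovariantDerivativeOnUniv.leibniz (γ.mdifferentiableAt_mul hW hξ) hf]
    simp [smul_sub]
    abel
  add {ξ ξ'} hξ hξ' := by
    have hmul : (fun y ↦ γ.mul y (W y) ((ξ + ξ') y))
        = (fun y ↦ γ.mul y (W y) (ξ y)) + fun y ↦ γ.mul y (W y) (ξ' y) := by
      ext y; simp
    simp only [hatDOp, hmul, (C.conj D).isCovariantDerivativeOnUniv.add hξ hξ',
      D.isCovariantDerivativeOnUniv.add (γ.mdifferentiableAt_mul hW hξ)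
        (γ.mdifferentiableAt_mul hW hξ')]
    simp
    abel

theorem hatD_apply {x : M} (v : TangentSpace 𝓘(ℝ, E) x)
    {W : Π y : M, TangentSpace 𝓘(ℝ, E) y} {ξ : Π y : M, S y}
    (hW : MDiffAt (T% W) x) (hξ : MDiffAt (T% ξ) x) :
    hatD C D nabla x v (W x) (ξ x) = hatDOp C D nabla x v W ξ := by
  have h := TensorialAt.pointwise₂ (fun _ ↦ tensorialAt_hatDOp_left C D nabla x v)
    (fun _ ↦ tensorialAt_hatDOp_right C D nabla x v)
    (FiberBundle.mdifferentiableAt_extend 𝓘(ℝ, E) E (W x)) hW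
    (FiberBundle.mdifferentiableAt_extend 𝓘(ℝ, E) F (ξ x)) hξ (by simp) (by simp)
  simpa only [hatD, hatDOp, FiberBundle.extend_apply_self] using h

/-- `(D̂_v γ)(w) s` as a linear function of `w`. -/
def hatDHom (x : M) (v : TangentSpace 𝓘(ℝ, E) x) (s : S x) : TangentSpace 𝓘(ℝ, E) x →L[ℝ] S x :=
  TensorialAt.mkHom _ x <| tensorialAt_hatDOp_left C D nabla x v
    (FiberBundle.mdifferentiableAt_extend 𝓘(ℝ, E) F s)

theorem hatDHom_apply (x : M) (v w : TangentSpace 𝓘(ℝ, E) x) (s : S x) :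
    hatDHom C D nabla x v s w = hatD C D nabla x v w s := by
  simp only [hatDHom, TensorialAt.mkHom_apply_eq_extend, hatDOp, hatD,
    FiberBundle.extend_apply_self]

end HatD

section Trivialization

variable {𝕜 : Type*} [RCLike 𝕜]
  {E : Type*} [NormedAddCommGroup E] [NormedSpace ℝ E]
  {M : Type*} [TopologicalSpace M] [ChartedSpace E M]
  {F : Type*} [NormedAddCommGroup F] [NormedSpace ℝ F] [NormedSpace 𝕜 F]
  {S : M → Type*} [TopologicalSpace (TotalSpace F S)] [∀ x, AddCommGroup (S x)]
  [∀ x, Module 𝕜 (S x)] [∀ x, TopologicalSpace (S x)] [FiberBundle F S] [VectorBundle 𝕜 F S]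

omit [NormedSpace ℝ F] in
variable (𝕜 F) in
theorem extend_eventuallyEq_symmₗ {x : M} (s : S x) :
    ∀ᶠ y in 𝓝 x, FiberBundle.extend F s y = (trivializationAt F S x).symmₗ 𝕜 y
      ((trivializationAt F S x).linearMapAt 𝕜 x s) := by
  filter_upwards [(trivializationAt F S x).open_baseSet.mem_nhds
    (FiberBundle.mem_baseSet_trivializationAt' x)] with y hy
  rw [Trivialization.coe_linearMapAt_of_mem _ (FiberBundle.mem_baseSet_trivializationAt' x),
    Trivialization.symmₗ_apply _ hy]
  rfl

variable (𝕜) in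
theorem mdifferentiableAt_linearMapAt {x : M} {ψ : Π y : M, S y} (hψ : MDiffAt (T% ψ) x) :
    MDiffAt (fun y ↦ (trivializationAt F S x).linearMapAt 𝕜 y (ψ y)) x := by
  rw [mdifferentiableAt_totalSpace] at hψ
  refine hψ.2.congr_of_eventuallyEq ?_
  filter_upwards [(trivializationAt F S x).open_baseSet.mem_nhds
    (FiberBundle.mem_baseSet_trivializationAt' x)] with y hy
  rw [Trivialization.coe_linearMapAt_of_mem _ hy]

variable (𝕜) in
theorem mvfderiv_linearMapAt_extend {x : M} (s : S x) :
    d% (fun y ↦ (trivializationAt F S x).linearMapAt 𝕜 y (FiberBundle.extend F s y)) x = 0 := by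
  have hconst : ∀ᶠ y in 𝓝 x, (trivializationAt F S x).linearMapAt 𝕜 y (FiberBundle.extend F s y)
      = (trivializationAt F S x).linearMapAt 𝕜 x s := by
    filter_upwards [extend_eventuallyEq_symmₗ 𝕜 F s, (trivializationAt F S x).open_baseSet.mem_nhds
      (FiberBundle.mem_baseSet_trivializationAt' x)] with y hs hy
    rw [hs, Trivialization.linearMapAt_symmₗ _ hy]
  rw [mvfderiv_congr hconst, mvfderiv_const]

namespace SpinorConnection

variable [IsManifold 𝓘(ℝ, E) ∞ M] [IsScalarTower ℝ 𝕜 F]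
  [∀ x, Module ℝ (S x)] [∀ x, IsScalarTower ℝ 𝕜 (S x)] [∀ x, IsTopologicalAddGroup (S x)]
  [∀ x, ContinuousSMul ℝ (S x)] [VectorBundle ℝ F S]
  (D : SpinorConnection 𝕜 E F S)

theorem tensorialAt_sub_trivialized (x : M) (v : TangentSpace 𝓘(ℝ, E) x) :
    TensorialAt 𝓘(ℝ, E) F (fun ψ : Π y : M, S y ↦ D.toFun ψ x v
      - (trivializationAt F S x).symmₗ 𝕜 x
        (d% (fun y ↦ (trivializationAt F S x).linearMapAt 𝕜 y (ψ y)) x v)) x where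
  smul {f ψ} hf hψ := by
    let t := trivializationAt F S x
    have hread : (fun y ↦ t.linearMapAt 𝕜 y ((f • ψ) y))
        = f • fun y ↦ t.linearMapAt 𝕜 y (ψ y) := by
      ext y
      exact (t.linearMapAt 𝕜 y).map_smul_of_tower (f y) (ψ y)
    have hsymm (c : ℝ) (s : F) : t.symmₗ 𝕜 x (c • s) = c • t.symmₗ 𝕜 x s :=
      (t.symmₗ 𝕜 x).map_smul_of_tower c s
    simp only [hread, t, mvfderiv_smul hf (mdifferentiableAt_linearMapAt 𝕜 hψ),
      D.isCovariantDerivativeOnUniv.leibniz hψ hf]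
    simp [t, hsymm, smul_sub,
      t.symmₗ_linearMapAt (FiberBundle.mem_baseSet_trivializationAt' x)]
  add {ψ ψ'} hψ hψ' := by
    have hread : (fun y ↦ (trivializationAt F S x).linearMapAt 𝕜 y ((ψ + ψ') y))
        = (fun y ↦ (trivializationAt F S x).linearMapAt 𝕜 y (ψ y))
          + fun y ↦ (trivializationAt F S x).linearMapAt 𝕜 y (ψ' y) := by
      ext y; simp
    simp only [hread, mvfderiv_add (mdifferentiableAt_linearMapAt 𝕜 hψ)
      (mdifferentiableAt_linearMapAt 𝕜 hψ'), D.isCovariantDerivativeOnUniv.add hψ hψ']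
    simp
    abel

variable [FiniteDimensional ℝ F] [ContMDiffVectorBundle ∞ F S 𝓘(ℝ, E)]

/-- The connection form of `D` in the trivialization of `S` around `x`: the endomorphism of `S x`
by which `D_v` differs from the derivative of the coordinates. -/
def connectionForm (x : M) (v : TangentSpace 𝓘(ℝ, E) x) : S x →ₗ[𝕜] S x where
  toFun s := D.toFun (FiberBundle.extend F s) x v
  map_add' s s' := by
    have hdiff (s : S x) := FiberBundle.mdifferentiableAt_extend 𝓘(ℝ, E) F s
    have hadd : D.toFun (FiberBundle.extend F s + FiberBundle.extend F s') x
        = D.toFun (FiberBundle.extend F (s + s')) x := by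
      refine D.toFun_congr (hdiff (s + s')) ?_
      filter_upwards [extend_eventuallyEq_symmₗ 𝕜 F s, extend_eventuallyEq_symmₗ 𝕜 F s',
        extend_eventuallyEq_symmₗ 𝕜 F (s + s')] with y hs hs' hsum
      rw [Pi.add_apply, hs, hs', hsum, map_add, map_add]
    rw [← hadd, D.isCovariantDerivativeOnUniv.add (hdiff s) (hdiff s'), add_apply]
  map_smul' c s := by
    have hdiff (s : S x) := FiberBundle.mdifferentiableAt_extend 𝓘(ℝ, E) F s
    have hsmul : D.toFun (fun y ↦ c • FiberBundle.extend F s y) x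
        = D.toFun (FiberBundle.extend F (c • s)) x := by
      refine D.toFun_congr (hdiff (c • s)) ?_
      filter_upwards [extend_eventuallyEq_symmₗ 𝕜 F s, extend_eventuallyEq_symmₗ 𝕜 F (c • s)]
        with y hs hcs
      rw [hs, hcs, map_smul, map_smul]
    rw [← hsmul, D.map_const_smul c (hdiff s) v, RingHom.id_apply]

theorem toFun_apply_eq {x : M} {ψ : Π y : M, S y} (hψ : MDiffAt (T% ψ) x)
    (v : TangentSpace 𝓘(ℝ, E) x) :
    D.toFun ψ x v = (trivializationAt F S x).symmₗ 𝕜 x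
        (d% (fun y ↦ (trivializationAt F S x).linearMapAt 𝕜 y (ψ y)) x v)
      + D.connectionForm x v (ψ x) := by
  have h := (D.tensorialAt_sub_trivialized x v).pointwise hψ
    (FiberBundle.mdifferentiableAt_extend 𝓘(ℝ, E) F (ψ x)) (by simp)
  simp only [mvfderiv_linearMapAt_extend] at h
  rw [zero_apply, map_zero, sub_zero] at h
  exact sub_eq_iff_eq_add'.1 h

end SpinorConnection

end Trivialization

/-! ### Derivations of bundles of exterior algebras -/

section ExteriorDerivation

variable {R V V' : Type*} [CommRing R] [AddCommGroup V] [Module R V] [AddCommGroup V'] [Module R V']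

theorem exteriorAlgebra_ι_mul_swap (v w : V) :
    ExteriorAlgebra.ι R v * ExteriorAlgebra.ι R w
      = -(ExteriorAlgebra.ι R w * ExteriorAlgebra.ι R v) :=
  eq_neg_of_add_eq_zero_left (ExteriorAlgebra.ι_add_mul_swap v w)

theorem involute_exteriorAlgebra_ι (v : V) :
    CliffordAlgebra.involute (ExteriorAlgebra.ι R v) = -ExteriorAlgebra.ι R v :=
  CliffordAlgebra.involute_ι v

theorem ι_mul_eq_involute_mul_ι (v : V) (a : ExteriorAlgebra R V) :
    ExteriorAlgebra.ι R v * a = CliffordAlgebra.involute a * ExteriorAlgebra.ι R v := by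
  induction a using ExteriorAlgebra.induction with
  | algebraMap r => simpa using (Algebra.commutes r (ExteriorAlgebra.ι R v)).symm
  | ι w => rw [exteriorAlgebra_ι_mul_swap, involute_exteriorAlgebra_ι, neg_mul]
  | mul a b ha hb => rw [← mul_assoc, ha, mul_assoc, hb, map_mul, mul_assoc]
  | add a b ha hb => rw [mul_add, ha, hb, map_add, add_mul]

theorem involute_map (f : V →ₗ[R] V') (a : ExteriorAlgebra R V) :
    CliffordAlgebra.involute (ExteriorAlgebra.map f a)
      = ExteriorAlgebra.map f (CliffordAlgebra.involute a) := by
  induction a using ExteriorAlgebra.induction with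
  | algebraMap r => simp
  | ι w => simp only [ExteriorAlgebra.map_apply_ι, involute_exteriorAlgebra_ι, map_neg]
  | mul a b ha hb => simp [ha, hb]
  | add a b ha hb => simp [ha, hb]

/-- The algebra homomorphism to the dual numbers whose dual part is the derivation of the exterior
algebra extending the endomorphism `A`. -/
def exteriorDualLift (A : V →ₗ[R] V) :
    ExteriorAlgebra R V →ₐ[R] DualNumber (ExteriorAlgebra R V) :=
  ExteriorAlgebra.lift R
    ⟨{ toFun := fun v ↦ (TrivSqZeroExt.inl (ExteriorAlgebra.ι R v)
          + TrivSqZeroExt.inr (ExteriorAlgebra.ι R (A v)) : DualNumber (ExteriorAlgebra R V))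
       map_add' := fun v w ↦ by ext <;> simp
       map_smul' := fun c v ↦ by ext <;> simp },
      fun v ↦ by
        ext
        · simp
        · simp [exteriorAlgebra_ι_mul_swap v]⟩

theorem fst_exteriorDualLift (A : V →ₗ[R] V) (a : ExteriorAlgebra R V) :
    (exteriorDualLift A a).fst = a := by
  have h : (TrivSqZeroExt.fstHom R (ExteriorAlgebra R V) (ExteriorAlgebra R V)).comp
      (exteriorDualLift A) = AlgHom.id R _ := by
    ext v
    simp [exteriorDualLift]
  exact AlgHom.congr_fun h a

/-- The derivation of the exterior algebra extending the endomorphism `A`. -/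
def exteriorDerivation (A : V →ₗ[R] V) : ExteriorAlgebra R V →ₗ[R] ExteriorAlgebra R V where
  toFun a := (exteriorDualLift A a).snd
  map_add' := by simp
  map_smul' := by simp

@[simp]
theorem exteriorDerivation_ι (A : V →ₗ[R] V) (v : V) :
    exteriorDerivation A (ExteriorAlgebra.ι R v) = ExteriorAlgebra.ι R (A v) := by
  simp [exteriorDerivation, exteriorDualLift]

@[simp]
theorem exteriorDerivation_algebraMap (A : V →ₗ[R] V) (r : R) :
    exteriorDerivation A (algebraMap R _ r) = 0 := by
  simp [exteriorDerivation, TrivSqZeroExt.algebraMap_eq_inl']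

theorem exteriorDerivation_mul (A : V →ₗ[R] V) (a b : ExteriorAlgebra R V) :
    exteriorDerivation A (a * b) = exteriorDerivation A a * b + a * exteriorDerivation A b := by
  have h := congrArg TrivSqZeroExt.snd (map_mul (exteriorDualLift A) a b)
  simp only [TrivSqZeroExt.snd_mul, fst_exteriorDualLift, smul_eq_mul, op_smul_eq_mul] at h
  simp only [exteriorDerivation, LinearMap.coe_mk, AddHom.coe_mk]
  rw [h, add_comm]

theorem exteriorDerivation_add (A B : V →ₗ[R] V) (a : ExteriorAlgebra R V) :
    exteriorDerivation (A + B) a = exteriorDerivation A a + exteriorDerivation B a := by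
  induction a using ExteriorAlgebra.induction with
  | algebraMap r => simp
  | ι v => simp
  | mul a b ha hb => simp only [exteriorDerivation_mul, ha, hb, add_mul, mul_add]; abel
  | add a b ha hb => simp only [map_add, ha, hb]; abel

theorem exteriorDerivation_smul (c : R) (A : V →ₗ[R] V) (a : ExteriorAlgebra R V) :
    exteriorDerivation (c • A) a = c • exteriorDerivation A a := by
  induction a using ExteriorAlgebra.induction with
  | algebraMap r => simp
  | ι v => simp
  | mul a b ha hb => simp [exteriorDerivation_mul, ha, hb]
  | add a b ha hb => simp [ha, hb]

theorem involute_exteriorDerivation (A : V →ₗ[R] V) (a : ExteriorAlgebra R V) :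
    CliffordAlgebra.involute (exteriorDerivation A a)
      = exteriorDerivation A (CliffordAlgebra.involute a) := by
  induction a using ExteriorAlgebra.induction with
  | algebraMap r => simp
  | ι w => simp only [exteriorDerivation_ι, involute_exteriorAlgebra_ι, map_neg]
  | mul a b ha hb => simp [exteriorDerivation_mul, ha, hb]
  | add a b ha hb => simp [ha, hb]

end ExteriorDerivation

section CoordDeriv

variable {E : Type*} [NormedAddCommGroup E] [NormedSpace ℝ E]
  {M : Type*} [TopologicalSpace M] [ChartedSpace E M]
  {W : Type*} [AddCommGroup W] [Module ℝ W] [Module.Finite ℝ W]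
  {W' : Type*} [AddCommGroup W'] [Module ℝ W'] [Module.Finite ℝ W']
  {W'' : Type*} [AddCommGroup W''] [Module ℝ W''] [Module.Finite ℝ W'']

variable (E) in
/-- Differentiability of a function with values in a finite dimensional real vector space without
a preferred norm, such as an exterior algebra; it refers to the coordinates in some basis. -/
def CoordDiffAt (f : M → W) (x : M) : Prop :=
  MDifferentiableAt 𝓘(ℝ, E) 𝓘(ℝ, Fin (Module.finrank ℝ W) → ℝ)
    (fun y ↦ (Module.finBasis ℝ W).equivFun (f y)) x

variable (E) in
/-- The derivative of a function with values in a finite dimensional real vector space without a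
preferred norm. -/
def coordDeriv (f : M → W) (x : M) : TangentSpace 𝓘(ℝ, E) x →ₗ[ℝ] W :=
  (Module.finBasis ℝ W).equivFun.symm.toLinearMap ∘ₗ
    (mvfderiv 𝓘(ℝ, E) (fun y ↦ (Module.finBasis ℝ W).equivFun (f y)) x).toLinearMap

variable {f : M → W} {x : M}

theorem equivFun_coordDeriv (f : M → W) (x : M) (v : TangentSpace 𝓘(ℝ, E) x) :
    (Module.finBasis ℝ W).equivFun (coordDeriv E f x v)
      = mvfderiv 𝓘(ℝ, E) (fun y ↦ (Module.finBasis ℝ W).equivFun (f y)) x v :=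
  LinearEquiv.apply_symm_apply _ _

theorem CoordDiffAt.congr {f' : M → W} (hf : CoordDiffAt E f x) (h : ∀ᶠ y in 𝓝 x, f' y = f y) :
    CoordDiffAt E f' x :=
  MDifferentiableAt.congr_of_eventuallyEq hf (h.mono fun y hy ↦ by simp only [hy])

theorem coordDeriv_congr {f' : M → W} (h : ∀ᶠ y in 𝓝 x, f' y = f y) :
    coordDeriv E f' x = coordDeriv E f x := by
  rw [coordDeriv, coordDeriv, mvfderiv_congr (h.mono fun y hy ↦ by rw [hy])]

theorem CoordDiffAt.add {f' : M → W} (hf : CoordDiffAt E f x) (hf' : CoordDiffAt E f' x) :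
    CoordDiffAt E (fun y ↦ f y + f' y) x := by
  simp only [CoordDiffAt, map_add]
  exact MDifferentiableAt.add hf hf'

theorem coordDeriv_add {f' : M → W} (hf : CoordDiffAt E f x) (hf' : CoordDiffAt E f' x) :
    coordDeriv E (fun y ↦ f y + f' y) x = coordDeriv E f x + coordDeriv E f' x := by
  ext v
  have h := DFunLike.congr_fun (mvfderiv_add hf hf') v
  simp only [coordDeriv, map_add, LinearMap.comp_apply, LinearMap.add_apply]
  exact (congrArg _ h).trans (map_add _ _ _)

/-- A linear map, read in the coordinates of its source. -/
def coordMap {G : Type*} [NormedAddCommGroup G] [NormedSpace ℝ G] (L : W →ₗ[ℝ] G) :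
    (Fin (Module.finrank ℝ W) → ℝ) →L[ℝ] G :=
  (L ∘ₗ (Module.finBasis ℝ W).equivFun.symm.toLinearMap).toContinuousLinearMap

theorem coordMap_equivFun {G : Type*} [NormedAddCommGroup G] [NormedSpace ℝ G] (L : W →ₗ[ℝ] G)
    (w : W) : coordMap L ((Module.finBasis ℝ W).equivFun w) = L w := by
  simp only [coordMap, LinearMap.coe_toContinuousLinearMap', LinearMap.comp_apply,
    LinearEquiv.coe_coe, LinearEquiv.symm_apply_apply]

theorem CoordDiffAt.mdifferentiableAt_linear_comp {G : Type*} [NormedAddCommGroup G]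
    [NormedSpace ℝ G] (L : W →ₗ[ℝ] G) (hf : CoordDiffAt E f x) : MDiffAt (fun y ↦ L (f y)) x := by
  simpa only [Function.comp_def, coordMap_equivFun] using (coordMap L).mdifferentiableAt.comp x hf

theorem mvfderiv_linear_comp {G : Type*} [NormedAddCommGroup G] [NormedSpace ℝ G]
    (L : W →ₗ[ℝ] G) (hf : CoordDiffAt E f x) (v : TangentSpace 𝓘(ℝ, E) x) :
    d% (fun y ↦ L (f y)) x v = L (coordDeriv E f x v) := by
  simpa only [← equivFun_coordDeriv, coordMap_equivFun] using mvfderiv_clm_comp (coordMap L) hf v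

theorem CoordDiffAt.linear_comp (L : W →ₗ[ℝ] W') (hf : CoordDiffAt E f x) :
    CoordDiffAt E (fun y ↦ L (f y)) x :=
  hf.mdifferentiableAt_linear_comp ((Module.finBasis ℝ W').equivFun.toLinearMap ∘ₗ L)

theorem coordDeriv_linear_comp (L : W →ₗ[ℝ] W') (hf : CoordDiffAt E f x) :
    coordDeriv E (fun y ↦ L (f y)) x = L ∘ₗ coordDeriv E f x := by
  ext v
  have h := mvfderiv_linear_comp ((Module.finBasis ℝ W').equivFun.toLinearMap ∘ₗ L) hf v
  exact (LinearEquiv.symm_apply_eq _).2 h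

/-- A bilinear map, read in coordinates. -/
def coordBilinearMap (B : W →ₗ[ℝ] W' →ₗ[ℝ] W'') : (Fin (Module.finrank ℝ W) → ℝ) →L[ℝ]
    (Fin (Module.finrank ℝ W') → ℝ) →L[ℝ] Fin (Module.finrank ℝ W'') → ℝ :=
  ((B.compl₁₂ (Module.finBasis ℝ W).equivFun.symm.toLinearMap
    (Module.finBasis ℝ W').equivFun.symm.toLinearMap).compr₂
    (Module.finBasis ℝ W'').equivFun.toLinearMap).toContinuousBilinearMap

theorem coordBilinearMap_equivFun (B : W →ₗ[ℝ] W' →ₗ[ℝ] W'') (w : W) (w' : W') :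
    coordBilinearMap B ((Module.finBasis ℝ W).equivFun w) ((Module.finBasis ℝ W').equivFun w')
      = (Module.finBasis ℝ W'').equivFun (B w w') := by
  simp only [coordBilinearMap, LinearMap.toContinuousBilinearMap_apply, LinearMap.compr₂_apply,
    LinearMap.compl₁₂_apply, LinearEquiv.coe_coe, LinearEquiv.symm_apply_apply]

theorem CoordDiffAt.bilinear (B : W →ₗ[ℝ] W' →ₗ[ℝ] W'') {f' : M → W'} (hf : CoordDiffAt E f x)
    (hf' : CoordDiffAt E f' x) : CoordDiffAt E (fun y ↦ B (f y) (f' y)) x := by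
  simpa only [CoordDiffAt, coordBilinearMap_equivFun] using
    (hasMFDerivAt_bilinear (coordBilinearMap B) hf hf').mdifferentiableAt

theorem coordDeriv_bilinear (B : W →ₗ[ℝ] W' →ₗ[ℝ] W'') {f' : M → W'} (hf : CoordDiffAt E f x)
    (hf' : CoordDiffAt E f' x) (v : TangentSpace 𝓘(ℝ, E) x) :
    coordDeriv E (fun y ↦ B (f y) (f' y)) x v
      = B (coordDeriv E f x v) (f' x) + B (f x) (coordDeriv E f' x v) := by
  refine (Module.finBasis ℝ W'').equivFun.injective ?_
  rw [map_add, equivFun_coordDeriv, ← coordBilinearMap_equivFun, ← coordBilinearMap_equivFun,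
    equivFun_coordDeriv, equivFun_coordDeriv]
  simpa only [coordBilinearMap_equivFun] using mvfderiv_bilinear (coordBilinearMap B) hf hf' v

end CoordDeriv

section CoordDerivNormed

variable {E : Type*} [NormedAddCommGroup E] [NormedSpace ℝ E]
  {M : Type*} [TopologicalSpace M] [ChartedSpace E M]
  {G : Type*} [NormedAddCommGroup G] [NormedSpace ℝ G] [FiniteDimensional ℝ G] {f : M → G} {x : M}

theorem coordDiffAt_of_mdifferentiableAt (hf : MDiffAt f x) : CoordDiffAt E f x :=
  (Module.finBasis ℝ G).equivFun.toLinearMap.toContinuousLinearMap.mdifferentiableAt.comp x hf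

theorem coordDeriv_eq_mvfderiv (hf : MDiffAt f x) (v : TangentSpace 𝓘(ℝ, E) x) :
    coordDeriv E f x v = d% f x v :=
  (mvfderiv_linear_comp LinearMap.id (coordDiffAt_of_mdifferentiableAt hf) v).symm

end CoordDerivNormed

instance finite_real_exteriorAlgebra {𝕜 V : Type*} [RCLike 𝕜] [AddCommGroup V] [Module ℝ V]
    [Module 𝕜 V] [IsScalarTower ℝ 𝕜 V] [Module.Finite ℝ V] :
    Module.Finite ℝ (ExteriorAlgebra 𝕜 V) := by
  have : Module.Finite 𝕜 V := Module.Finite.of_restrictScalars_finite ℝ 𝕜 V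
  have : Module.Finite 𝕜 (ExteriorAlgebra 𝕜 V) :=
    Module.Finite.of_basis (Module.finBasis 𝕜 V).ExteriorAlgebra
  exact Module.Finite.trans 𝕜 _

section ReadSuper

variable {𝕜 : Type*} [RCLike 𝕜]
  {M : Type*} [TopologicalSpace M]
  {F : Type*} [NormedAddCommGroup F] [NormedSpace 𝕜 F]
  {S : M → Type*} [TopologicalSpace (TotalSpace F S)] [∀ x, AddCommGroup (S x)]
  [∀ x, Module 𝕜 (S x)] [∀ x, TopologicalSpace (S x)] [FiberBundle F S] [VectorBundle 𝕜 F S]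

variable (F) in
/-- A section of the bundle of exterior algebras of `S`, read in the trivialization of `S` around
`x`. -/
def readSuper (x : M) (α : Π y : M, ExteriorAlgebra 𝕜 (S y)) (y : M) : ExteriorAlgebra 𝕜 F :=
  ExteriorAlgebra.map ((trivializationAt F S x).linearMapAt 𝕜 y) (α y)

variable {x : M} {α β : Π y : M, ExteriorAlgebra 𝕜 (S y)}

theorem map_symmₗ_readSuper (α : Π y : M, ExteriorAlgebra 𝕜 (S y)) :
    ExteriorAlgebra.map ((trivializationAt F S x).symmₗ 𝕜 x) (readSuper F x α x) = α x := by
  have h : (ExteriorAlgebra.map ((trivializationAt F S x).symmₗ 𝕜 x)).comp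
      (ExteriorAlgebra.map ((trivializationAt F S x).linearMapAt 𝕜 x)) = AlgHom.id 𝕜 _ := by
    ext s
    simp [Trivialization.symmₗ_linearMapAt _ (FiberBundle.mem_baseSet_trivializationAt' x)]
  exact AlgHom.congr_fun h (α x)

theorem readSuper_congr (h : ∀ᶠ y in 𝓝 x, β y = α y) :
    ∀ᶠ y in 𝓝 x, readSuper F x β y = readSuper F x α y :=
  h.mono fun y hy ↦ by rw [readSuper, hy, readSuper]

theorem readSuper_add (x : M) (α β : Π y : M, ExteriorAlgebra 𝕜 (S y)) :
    readSuper F x (α + β) = fun y ↦ readSuper F x α y + readSuper F x β y :=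
  funext fun _ ↦ map_add _ _ _

theorem readSuper_mul (x : M) (α β : Π y : M, ExteriorAlgebra 𝕜 (S y)) :
    readSuper F x (α * β) = fun y ↦ readSuper F x α y * readSuper F x β y :=
  funext fun _ ↦ map_mul _ _ _

theorem readSuper_smul (x : M) (c : 𝕜) (α : Π y : M, ExteriorAlgebra 𝕜 (S y)) :
    readSuper F x (c • α) = fun y ↦ c • readSuper F x α y :=
  funext fun y ↦ map_smul (ExteriorAlgebra.map _) c (α y)

theorem readSuper_function (x : M) (f : M → 𝕜) :
    readSuper F x (fun y : M ↦ algebraMap 𝕜 (ExteriorAlgebra 𝕜 (S y)) (f y))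
      = fun y ↦ algebraMap 𝕜 (ExteriorAlgebra 𝕜 F) (f y) :=
  funext fun _ ↦ AlgHom.commutes _ _

theorem readSuper_spinor (x : M) (ψ : Π y : M, S y) :
    readSuper F x (fun y : M ↦ ExteriorAlgebra.ι 𝕜 (ψ y))
      = fun y ↦ ExteriorAlgebra.ι 𝕜 ((trivializationAt F S x).linearMapAt 𝕜 y (ψ y)) :=
  funext fun _ ↦ ExteriorAlgebra.map_apply_ι _ _

theorem readSuper_parity (x : M) (α : Π y : M, ExteriorAlgebra 𝕜 (S y)) :
    readSuper F x (fun y ↦ parity y (α y))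
      = fun y ↦ CliffordAlgebra.involute (readSuper F x α y) :=
  funext fun _ ↦ (involute_map _ _).symm

end ReadSuper

section SuperDeriv

variable {𝕜 : Type*} [RCLike 𝕜]
  {E : Type*} [NormedAddCommGroup E] [NormedSpace ℝ E]
  {M : Type*} [TopologicalSpace M] [ChartedSpace E M]
  {F : Type*} [NormedAddCommGroup F] [NormedSpace ℝ F] [NormedSpace 𝕜 F] [IsScalarTower ℝ 𝕜 F]
  [FiniteDimensional ℝ F]
  {S : M → Type*} [TopologicalSpace (TotalSpace F S)] [∀ x, AddCommGroup (S x)]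
  [∀ x, Module 𝕜 (S x)] [∀ x, TopologicalSpace (S x)] [FiberBundle F S] [VectorBundle 𝕜 F S]

variable (E F) in
/-- Differentiability at `x` of a section of the bundle of exterior algebras of `S`. -/
def SuperDiffAt (α : Π y : M, ExteriorAlgebra 𝕜 (S y)) (x : M) : Prop :=
  CoordDiffAt E (readSuper F x α) x

variable {x : M} {α β : Π y : M, ExteriorAlgebra 𝕜 (S y)}

namespace SuperDiffAt

theorem congr (hα : SuperDiffAt E F α x) (h : ∀ᶠ y in 𝓝 x, β y = α y) : SuperDiffAt E F β x :=
  CoordDiffAt.congr hα (readSuper_congr h)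

theorem add (hα : SuperDiffAt E F α x) (hβ : SuperDiffAt E F β x) :
    SuperDiffAt E F (α + β) x := by
  rw [SuperDiffAt, readSuper_add]
  exact CoordDiffAt.add hα hβ

theorem mul (hα : SuperDiffAt E F α x) (hβ : SuperDiffAt E F β x) :
    SuperDiffAt E F (α * β) x := by
  rw [SuperDiffAt, readSuper_mul]
  exact CoordDiffAt.bilinear (LinearMap.mul ℝ (ExteriorAlgebra 𝕜 F)) hα hβ

theorem function {f : M → 𝕜} (hf : MDifferentiableAt 𝓘(ℝ, E) 𝓘(ℝ, 𝕜) f x) :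
    SuperDiffAt E F (fun y : M ↦ algebraMap 𝕜 (ExteriorAlgebra 𝕜 (S y)) (f y)) x := by
  rw [SuperDiffAt, readSuper_function]
  exact (coordDiffAt_of_mdifferentiableAt hf).linear_comp
    ((Algebra.linearMap 𝕜 (ExteriorAlgebra 𝕜 F)).restrictScalars ℝ)

theorem spinor {ψ : Π y : M, S y} (hψ : MDiffAt (T% ψ) x) :
    SuperDiffAt E F (fun y : M ↦ ExteriorAlgebra.ι 𝕜 (ψ y)) x := by
  rw [SuperDiffAt, readSuper_spinor]
  exact (coordDiffAt_of_mdifferentiableAt (mdifferentiableAt_linearMapAt 𝕜 hψ)).linear_comp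
    ((ExteriorAlgebra.ι 𝕜).restrictScalars ℝ)

end SuperDiffAt

variable [IsManifold 𝓘(ℝ, E) ∞ M]
  [∀ x, Module ℝ (S x)] [∀ x, IsScalarTower ℝ 𝕜 (S x)] [∀ x, IsTopologicalAddGroup (S x)]
  [∀ x, ContinuousSMul ℝ (S x)] [VectorBundle ℝ F S] (D : SpinorConnection 𝕜 E F S)

/-- The extension of the covariant derivative `D` at `x` to sections of the bundle of exterior
algebras of `S`, as an even derivation along each tangent vector. -/
def superDeriv (x : M) (α : Π y : M, ExteriorAlgebra 𝕜 (S y)) :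
    TangentSpace 𝓘(ℝ, E) x →ₗ[ℝ] ExteriorAlgebra 𝕜 (S x) where
  toFun v := ExteriorAlgebra.map ((trivializationAt F S x).symmₗ 𝕜 x)
      (coordDeriv E (readSuper F x α) x v) + exteriorDerivation (D.connectionForm x v) (α x)
  map_add' v w := by
    have h : D.connectionForm x (v + w) = D.connectionForm x v + D.connectionForm x w := by
      ext s; simp [SpinorConnection.connectionForm]
    rw [h, exteriorDerivation_add, map_add, map_add]
    abel
  map_smul' c v := by
    have h : D.connectionForm x (c • v) = algebraMap ℝ 𝕜 c • D.connectionForm x v := by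
      ext s; simp [SpinorConnection.connectionForm]
    rw [h, exteriorDerivation_smul, map_smul, ← algebraMap_smul 𝕜 c (coordDeriv E _ x v), map_smul,
      ← smul_add, algebraMap_smul, RingHom.id_apply]

theorem superDeriv_apply (x : M) (α : Π y : M, ExteriorAlgebra 𝕜 (S y))
    (v : TangentSpace 𝓘(ℝ, E) x) :
    superDeriv D x α v = ExteriorAlgebra.map ((trivializationAt F S x).symmₗ 𝕜 x)
      (coordDeriv E (readSuper F x α) x v) + exteriorDerivation (D.connectionForm x v) (α x) :=
  rfl

theorem superDeriv_congr (h : ∀ᶠ y in 𝓝 x, β y = α y) : superDeriv D x β = superDeriv D x α := by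
  ext v
  rw [superDeriv_apply, superDeriv_apply, coordDeriv_congr (readSuper_congr (F := F) h),
    h.self_of_nhds]

theorem superDeriv_add (hα : SuperDiffAt E F α x) (hβ : SuperDiffAt E F β x) :
    superDeriv D x (α + β) = superDeriv D x α + superDeriv D x β := by
  ext v
  simp only [superDeriv_apply, readSuper_add, coordDeriv_add hα hβ, LinearMap.add_apply, map_add,
    Pi.add_apply]
  abel

theorem superDeriv_mul (hα : SuperDiffAt E F α x) (hβ : SuperDiffAt E F β x)
    (v : TangentSpace 𝓘(ℝ, E) x) :
    superDeriv D x (α * β) v = superDeriv D x α v * β x + α x * superDeriv D x β v := by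
  have h : coordDeriv E (readSuper F x (α * β)) x v
      = coordDeriv E (readSuper F x α) x v * readSuper F x β x
        + readSuper F x α x * coordDeriv E (readSuper F x β) x v := by
    rw [readSuper_mul]
    exact coordDeriv_bilinear (LinearMap.mul ℝ (ExteriorAlgebra 𝕜 F)) hα hβ v
  simp only [superDeriv_apply, h, map_add, map_mul, Pi.mul_apply, map_symmₗ_readSuper,
    exteriorDerivation_mul]
  simp only [add_mul, mul_add]
  abel

theorem superDeriv_smul (hα : SuperDiffAt E F α x) (c : 𝕜) (v : TangentSpace 𝓘(ℝ, E) x) :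
    superDeriv D x (c • α) v = c • superDeriv D x α v := by
  have h := DFunLike.congr_fun (coordDeriv_linear_comp
    ((c • LinearMap.id (R := 𝕜) (M := ExteriorAlgebra 𝕜 F)).restrictScalars ℝ) hα) v
  simp only [LinearMap.restrictScalars_apply, LinearMap.smul_apply, LinearMap.id_apply,
    LinearMap.comp_apply] at h
  rw [superDeriv_apply, readSuper_smul, h, superDeriv_apply]
  simp

theorem superDeriv_function {f : M → 𝕜} (hf : MDifferentiableAt 𝓘(ℝ, E) 𝓘(ℝ, 𝕜) f x)
    (v : TangentSpace 𝓘(ℝ, E) x) :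
    superDeriv D x (fun y ↦ algebraMap 𝕜 (ExteriorAlgebra 𝕜 (S y)) (f y)) v
      = algebraMap 𝕜 _ (mvfderiv 𝓘(ℝ, E) f x v) := by
  have h := DFunLike.congr_fun (coordDeriv_linear_comp
    ((Algebra.linearMap 𝕜 (ExteriorAlgebra 𝕜 F)).restrictScalars ℝ)
    (coordDiffAt_of_mdifferentiableAt hf)) v
  simp only [LinearMap.restrictScalars_apply, Algebra.linearMap_apply, LinearMap.comp_apply,
    coordDeriv_eq_mvfderiv hf] at h
  rw [superDeriv_apply, readSuper_function, h, exteriorDerivation_algebraMap, AlgHom.commutes,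
    add_zero]

theorem superDeriv_parity (hα : SuperDiffAt E F α x) (v : TangentSpace 𝓘(ℝ, E) x) :
    superDeriv D x (fun y ↦ parity y (α y)) v = parity x (superDeriv D x α v) := by
  have h := DFunLike.congr_fun (coordDeriv_linear_comp ((CliffordAlgebra.involute :
    ExteriorAlgebra 𝕜 F →ₐ[𝕜] ExteriorAlgebra 𝕜 F).toLinearMap.restrictScalars ℝ) hα) v
  simp only [LinearMap.restrictScalars_apply, AlgHom.toLinearMap_apply,
    LinearMap.comp_apply] at h
  rw [superDeriv_apply, readSuper_parity, h, superDeriv_apply]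
  simp only [parity, map_add, involute_map, involute_exteriorDerivation]

variable [ContMDiffVectorBundle ∞ F S 𝓘(ℝ, E)]

theorem superDeriv_spinor {ψ : Π y : M, S y} (hψ : MDiffAt (T% ψ) x)
    (v : TangentSpace 𝓘(ℝ, E) x) :
    superDeriv D x (fun y ↦ ExteriorAlgebra.ι 𝕜 (ψ y)) v
      = ExteriorAlgebra.ι 𝕜 (D.toFun ψ x v) := by
  have hread := mdifferentiableAt_linearMapAt 𝕜 hψ
  have h := DFunLike.congr_fun (coordDeriv_linear_comp
    ((ExteriorAlgebra.ι 𝕜 (M := F)).restrictScalars ℝ) (coordDiffAt_of_mdifferentiableAt hread)) v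
  simp only [LinearMap.restrictScalars_apply, LinearMap.comp_apply,
    coordDeriv_eq_mvfderiv hread] at h
  rw [superDeriv_apply, readSuper_spinor, h, exteriorDerivation_ι, ExteriorAlgebra.map_apply_ι,
    ← map_add, ← D.toFun_apply_eq hψ]

end SuperDeriv

section SuperFunctions

variable {𝕜 : Type*} [RCLike 𝕜]
  {E : Type*} [NormedAddCommGroup E] [NormedSpace ℝ E]
  {M : Type*} [TopologicalSpace M] [ChartedSpace E M]
  {F : Type*} [NormedAddCommGroup F] [NormedSpace ℝ F]
  {S : M → Type*} [TopologicalSpace (TotalSpace F S)] [∀ x, AddCommGroup (S x)]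
  [∀ x, Module 𝕜 (S x)] [∀ x, TopologicalSpace (S x)] [FiberBundle F S]
  {α : Π y : M, ExteriorAlgebra 𝕜 (S y)}

theorem mem_superFunctions_of_locally
    (h : ∀ x, ∃ β ∈ SuperFunctions 𝕜 E F S, ∀ᶠ y in 𝓝 x, α y = β y) :
    α ∈ SuperFunctions 𝕜 E F S := fun x ↦ by
  obtain ⟨β, hβ, hαβ⟩ := h x
  obtain ⟨β', hβ', hββ'⟩ := hβ x
  exact ⟨β', hβ', hαβ.mp (hββ'.mono fun y h h' ↦ h'.trans h)⟩

@[elab_as_elim]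
theorem SuperFunctions.induction {p : ∀ α, α ∈ SuperFunctions 𝕜 E F S → Prop}
    (function : ∀ f : M → 𝕜, ContMDiff 𝓘(ℝ, E) 𝓘(ℝ, 𝕜) ∞ f → ∀ hf,
      p (fun y ↦ algebraMap 𝕜 (ExteriorAlgebra 𝕜 (S y)) (f y)) hf)
    (spinor : ∀ ψ : Π y : M, S y, CMDiff ∞ (T% ψ) → ∀ hψ,
      p (fun y ↦ ExteriorAlgebra.ι 𝕜 (ψ y)) hψ)
    (add : ∀ α β hα hβ, p α hα → p β hβ → p (α + β) (add_mem hα hβ))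
    (mul : ∀ α β hα hβ, p α hα → p β hβ → p (α * β) (mul_mem hα hβ))
    (locally : ∀ α hα, (∀ x, ∃ β hβ, p β hβ ∧ ∀ᶠ y in 𝓝 x, α y = β y) → p α hα)
    (hα : α ∈ SuperFunctions 𝕜 E F S) : p α hα := by
  have hmem {β} (hβ : β ∈ Algebra.adjoin 𝕜 (generators 𝕜 E F S)) : β ∈ SuperFunctions 𝕜 E F S :=
    fun _ ↦ ⟨β, hβ, Filter.Eventually.of_forall fun _ ↦ rfl⟩
  refine locally α hα fun x ↦ ?_
  obtain ⟨β, hβ, hαβ⟩ := hα x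
  refine ⟨β, hmem hβ, ?_, hαβ⟩
  clear hαβ
  induction hβ using Algebra.adjoin_induction with
  | mem β hβ =>
    rcases hβ with ⟨f, hf, rfl⟩ | ⟨ψ, hψ, rfl⟩
    exacts [function f hf _, spinor ψ hψ _]
  | algebraMap c => exact function (fun _ ↦ c) contMDiff_const _
  | add β β' hβ hβ' h h' => exact add β β' (hmem hβ) (hmem hβ') h h'
  | mul β β' hβ hβ' h h' => exact mul β β' (hmem hβ) (hmem hβ') h h'

end SuperFunctions

section SuperFunctionsDeriv

variable {𝕜 : Type*} [RCLike 𝕜]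
  {E : Type*} [NormedAddCommGroup E] [NormedSpace ℝ E]
  {M : Type*} [TopologicalSpace M] [ChartedSpace E M]
  {F : Type*} [NormedAddCommGroup F] [NormedSpace ℝ F] [NormedSpace 𝕜 F] [IsScalarTower ℝ 𝕜 F]
  [FiniteDimensional ℝ F]
  {S : M → Type*} [TopologicalSpace (TotalSpace F S)] [∀ x, AddCommGroup (S x)]
  [∀ x, Module 𝕜 (S x)] [∀ x, TopologicalSpace (S x)] [FiberBundle F S] [VectorBundle 𝕜 F S]
  {α : Π y : M, ExteriorAlgebra 𝕜 (S y)}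

theorem superDiffAt_of_mem (hα : α ∈ SuperFunctions 𝕜 E F S) (x : M) : SuperDiffAt E F α x := by
  induction hα using SuperFunctions.induction with
  | function f hf _ => exact .function (hf.mdifferentiable (by simp) x)
  | spinor ψ hψ _ => exact .spinor (hψ.mdifferentiable (by simp) x)
  | add α β _ _ h h' => exact h.add h'
  | mul α β _ _ h h' => exact h.mul h'
  | locally α _ h =>
    obtain ⟨β, _, hβ, hαβ⟩ := h x
    exact hβ.congr hαβ

variable [IsManifold 𝓘(ℝ, E) ∞ M] [∀ x, Module ℝ (S x)] [∀ x, IsScalarTower ℝ 𝕜 (S x)]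
  [∀ x, IsTopologicalAddGroup (S x)] [∀ x, ContinuousSMul ℝ (S x)] [VectorBundle ℝ F S]

theorem superDeriv_sum (D : SpinorConnection 𝕜 E F S) {x : M} {κ : Type*} (s : Finset κ)
    {α : κ → Π y : M, ExteriorAlgebra 𝕜 (S y)} (hα : ∀ i, α i ∈ SuperFunctions 𝕜 E F S) :
    superDeriv D x (∑ i ∈ s, α i) = ∑ i ∈ s, superDeriv D x (α i) := by
  classical
  induction s using Finset.induction_on with
  | empty =>
    ext v
    simpa using superDeriv_smul D
      (superDiffAt_of_mem (zero_mem (SuperFunctions 𝕜 E F S)) x) 0 v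
  | insert i s hi ih =>
    rw [Finset.sum_insert hi, Finset.sum_insert hi, ← ih, superDeriv_add D
      (superDiffAt_of_mem (hα i) x) (superDiffAt_of_mem (sum_mem fun j _ ↦ hα j) x)]

variable [FiniteDimensional ℝ E] [ContMDiffVectorBundle ∞ F S 𝓘(ℝ, E)]

theorem parity_mem_superFunctions (hα : α ∈ SuperFunctions 𝕜 E F S) :
    (fun y ↦ parity y (α y)) ∈ SuperFunctions 𝕜 E F S := by
  induction hα using SuperFunctions.induction with
  | function f hf _ =>
    simp only [AlgHom.commutes]
    exact (ofFunction f hf : SuperFunctions 𝕜 E F S).2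
  | spinor ψ hψ _ =>
    simp only [parity, involute_exteriorAlgebra_ι]
    exact neg_mem (ofSpinor ψ hψ : SuperFunctions 𝕜 E F S).2
  | add α β _ _ h h' =>
    simp only [Pi.add_apply, map_add]
    exact add_mem h h'
  | mul α β _ _ h h' =>
    simp only [Pi.mul_apply, map_mul]
    exact mul_mem h h'
  | locally α _ h =>
    exact mem_superFunctions_of_locally fun x ↦
      let ⟨β, _, hβ, hαβ⟩ := h x
      ⟨_, hβ, hαβ.mono fun y hy ↦ by rw [hy]⟩

theorem superDeriv_mem (D : SpinorConnection 𝕜 E F S) (hα : α ∈ SuperFunctions 𝕜 E F S)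
    {V : Π y : M, TangentSpace 𝓘(ℝ, E) y} (hV : CMDiff ∞ (T% V)) :
    (fun y ↦ superDeriv D y α (V y)) ∈ SuperFunctions 𝕜 E F S := by
  induction hα using SuperFunctions.induction with
  | function f hf _ =>
    simp only [superDeriv_function D (hf.mdifferentiable (by simp) _)]
    exact (ofFunction _ (contMDiff_mvfderiv_apply hf hV) : SuperFunctions 𝕜 E F S).2
  | spinor ψ hψ _ =>
    simp only [superDeriv_spinor D (hψ.mdifferentiable (by simp) _)]
    exact (ofSpinor _ (D.contMDiff_apply hψ hV) : SuperFunctions 𝕜 E F S).2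
  | add α β hα hβ h h' =>
    simp only [superDeriv_add D (superDiffAt_of_mem hα _) (superDiffAt_of_mem hβ _),
      LinearMap.add_apply]
    exact add_mem h h'
  | mul α β hα hβ h h' =>
    simp only [superDeriv_mul D (superDiffAt_of_mem hα _) (superDiffAt_of_mem hβ _)]
    exact add_mem (mul_mem h hβ) (mul_mem hα h')
  | locally α _ h =>
    exact mem_superFunctions_of_locally fun x ↦
      let ⟨β, _, hβ, hαβ⟩ := h x
      ⟨_, hβ, hαβ.eventually_nhds.mono fun y hy ↦ by rw [superDeriv_congr D hy]⟩

end SuperFunctionsDeriv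

section OddVectorField

variable {𝕜 : Type*} [RCLike 𝕜]
  {E : Type*} [NormedAddCommGroup E] [NormedSpace ℝ E] [FiniteDimensional ℝ E]
  {M : Type*} [TopologicalSpace M] [ChartedSpace E M] [IsManifold 𝓘(ℝ, E) ∞ M] [T2Space M]
  {F : Type*} [NormedAddCommGroup F] [NormedSpace ℝ F] [NormedSpace 𝕜 F] [FiniteDimensional ℝ F]
  {S : M → Type*} [TopologicalSpace (TotalSpace F S)] [∀ x, AddCommGroup (S x)]
  [∀ x, Module ℝ (S x)] [∀ x, Module 𝕜 (S x)] [∀ x, IsScalarTower ℝ 𝕜 (S x)]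
  [∀ x, TopologicalSpace (S x)] [∀ x, IsTopologicalAddGroup (S x)]
  [∀ x, ContinuousSMul ℝ (S x)] [FiberBundle F S] [VectorBundle ℝ F S] [VectorBundle 𝕜 F S]
  [ContMDiffVectorBundle ∞ F S 𝓘(ℝ, E)]

namespace OddVectorField

theorem apply_eq_zero (Q : OddVectorField 𝕜 E F S) (α : SuperFunctions 𝕜 E F S) {x : M}
    (h : ∀ᶠ y in 𝓝 x, α.1 y = 0) : (Q.toFun α).1 x = 0 := by
  obtain ⟨ρ, hρ, hone, hsupp⟩ := exists_smooth_cutoff (E := E) h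
  have hρ' : ContMDiff 𝓘(ℝ, E) 𝓘(ℝ, 𝕜) ∞ fun y ↦ (ρ y : 𝕜) :=
    (RCLike.ofRealCLM (K := 𝕜)).contMDiff.comp hρ
  let ρ' : SuperFunctions 𝕜 E F S := ofFunction _ hρ'
  have hρx : ρ'.1 x = 1 := by simp [ρ', ofFunction, hone.self_of_nhds]
  have hprod : ρ' * α = 0 := Subtype.ext <| funext fun y ↦ by
    by_cases hy : y ∈ tsupport ρ
    · exact (congrArg (ρ'.1 y * ·) (hsupp hy)).trans (mul_zero _)
    · have : ρ'.1 y = 0 := by simp [ρ', ofFunction, image_eq_zero_of_notMem_tsupport hy]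
      exact (congrArg (· * α.1 y) this).trans (zero_mul _)
  have hzero : Q.toFun 0 = 0 := Q.toLinearMap.map_zero
  simpa [hprod, hzero, hρx, h.self_of_nhds] using (Q.leibniz ρ' α x).symm

theorem apply_congr (Q : OddVectorField 𝕜 E F S) {α β : SuperFunctions 𝕜 E F S} {x : M}
    (h : ∀ᶠ y in 𝓝 x, α.1 y = β.1 y) : (Q.toFun α).1 x = (Q.toFun β).1 x := by
  have hsub : Q.toFun (α - β) = Q.toFun α - Q.toFun β := Q.toLinearMap.map_sub α β
  have hzero := Q.apply_eq_zero (α - β) (h.mono fun y hy ↦ sub_eq_zero.2 hy)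
  rw [hsub] at hzero
  exact sub_eq_zero.1 hzero

theorem ext_of_generators {Q Q' : OddVectorField 𝕜 E F S}
    (function : ∀ (f : M → 𝕜) (hf : ContMDiff 𝓘(ℝ, E) 𝓘(ℝ, 𝕜) ∞ f),
      Q.toFun (ofFunction f hf) = Q'.toFun (ofFunction f hf))
    (spinor : ∀ (ψ : Π x : M, S x) (hψ : CMDiff ∞ (T% ψ)),
      Q.toFun (ofSpinor ψ hψ) = Q'.toFun (ofSpinor ψ hψ)) : Q = Q' := by
  suffices h : ∀ α (hα : α ∈ SuperFunctions 𝕜 E F S), Q.toFun ⟨α, hα⟩ = Q'.toFun ⟨α, hα⟩ by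
    cases Q
    cases Q'
    congr 1
    exact LinearMap.ext fun α ↦ h α.1 α.2
  intro α hα
  induction hα using SuperFunctions.induction with
  | function f hf _ => exact function f hf
  | spinor ψ hψ _ => exact spinor ψ hψ
  | add α β hα hβ h h' =>
    exact (Q.toLinearMap.map_add ⟨α, hα⟩ ⟨β, hβ⟩).trans
      ((congrArg₂ _ h h').trans (Q'.toLinearMap.map_add ⟨α, hα⟩ ⟨β, hβ⟩).symm)
  | mul α β hα hβ h h' =>
    refine Subtype.ext <| funext fun x ↦ (Q.leibniz ⟨α, hα⟩ ⟨β, hβ⟩ x).trans ?_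
    rw [h, h']
    exact (Q'.leibniz ⟨α, hα⟩ ⟨β, hβ⟩ x).symm
  | locally α hα h =>
    refine Subtype.ext <| funext fun x ↦ ?_
    obtain ⟨β, hβ, heq, hαβ⟩ := h x
    rw [Q.apply_congr (α := ⟨α, hα⟩) (β := ⟨β, hβ⟩) hαβ, heq,
      Q'.apply_congr (α := ⟨α, hα⟩) (β := ⟨β, hβ⟩) hαβ]

end OddVectorField

end OddVectorField

/-! ### The odd vector field `ı(η)` and its square -/

section Imath

variable {𝕜 : Type*} [RCLike 𝕜]
  {E : Type*} [NormedAddCommGroup E] [NormedSpace ℝ E] [FiniteDimensional ℝ E]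
  {M : Type*} [TopologicalSpace M] [ChartedSpace E M] [IsManifold 𝓘(ℝ, E) ∞ M]
  {F : Type*} [NormedAddCommGroup F] [NormedSpace ℝ F]
  {S : M → Type*} [TopologicalSpace (TotalSpace F S)] [∀ x, AddCommGroup (S x)]
  [∀ x, Module ℝ (S x)] [∀ x, Module 𝕜 (S x)] [∀ x, IsScalarTower ℝ 𝕜 (S x)]
  [∀ x, TopologicalSpace (S x)] [∀ x, IsTopologicalAddGroup (S x)]
  [∀ x, ContinuousSMul ℝ (S x)] [FiberBundle F S] [VectorBundle ℝ F S]
  {g : PseudoRiemannianMetric E M}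

/-- The map `v ↦ γ(v) s` with values in the part of degree one of the exterior algebra. -/
def CliffordMultiplication.mulι (γ : CliffordMultiplication 𝕜 g F S) {x : M} (s : S x) :
    TangentSpace 𝓘(ℝ, E) x →ₗ[ℝ] ExteriorAlgebra 𝕜 (S x) where
  toFun v := ExteriorAlgebra.ι 𝕜 (γ.mul x v s)
  map_add' v w := by simp
  map_smul' c v := by
    rw [map_smul, smul_apply, ← algebraMap_smul 𝕜 c, map_smul, algebraMap_smul, RingHom.id_apply]

theorem CliffordMultiplication.mulι_apply (γ : CliffordMultiplication 𝕜 g F S) {x : M} (s : S x)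
    (v : TangentSpace 𝓘(ℝ, E) x) : γ.mulι s v = ExteriorAlgebra.ι 𝕜 (γ.mul x v s) :=
  rfl

variable [NormedSpace 𝕜 F] [IsScalarTower ℝ 𝕜 F] [FiniteDimensional ℝ F] [VectorBundle 𝕜 F S]
  {γ : CliffordMultiplication 𝕜 g F S} {D : SpinorConnection 𝕜 E F S}
  {η : Π x : M, S x}

variable (γ D η) in
/-- The action of `γ^μ η ⊗ D_μ` on sections of the bundle of exterior algebras of `S`. -/
def imathFun (α : Π x : M, ExteriorAlgebra 𝕜 (S x)) (x : M) : ExteriorAlgebra 𝕜 (S x) :=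
  g.contract x fun v w ↦ γ.mulι (η x) v * superDeriv D x α w

variable {x : M} {α β : Π y : M, ExteriorAlgebra 𝕜 (S y)}

theorem imathFun_eq_sum {e e' : Fin (Module.finrank ℝ E) → TangentSpace 𝓘(ℝ, E) x}
    (h : g.IsDualFrame e' e) :
    imathFun γ D η α x = ∑ μ, γ.mulι (η x) (e' μ) * superDeriv D x α (e μ) :=
  h.contract_eq_sum
    ((LinearMap.mul ℝ (ExteriorAlgebra 𝕜 (S x))).compl₁₂ (γ.mulι (η x)) (superDeriv D x α))

theorem imathFun_congr (h : ∀ᶠ y in 𝓝 x, α y = β y) : imathFun γ D η α x = imathFun γ D η β x := by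
  rw [imathFun, superDeriv_congr D h, imathFun]

theorem imathFun_add (hα : SuperDiffAt E F α x) (hβ : SuperDiffAt E F β x) :
    imathFun γ D η (α + β) x = imathFun γ D η α x + imathFun γ D η β x := by
  simp only [imathFun, PseudoRiemannianMetric.contract, superDeriv_add D hα hβ,
    LinearMap.add_apply, mul_add, Finset.sum_add_distrib]

theorem imathFun_smul (hα : SuperDiffAt E F α x) (c : 𝕜) :
    imathFun γ D η (c • α) x = c • imathFun γ D η α x := by
  simp only [imathFun, PseudoRiemannianMetric.contract, superDeriv_smul D hα, mul_smul_comm,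
    Finset.smul_sum]

theorem imathFun_mul (hα : SuperDiffAt E F α x) (hβ : SuperDiffAt E F β x) :
    imathFun γ D η (α * β) x
      = imathFun γ D η α x * β x + parity x (α x) * imathFun γ D η β x := by
  simp only [imathFun, PseudoRiemannianMetric.contract, superDeriv_mul D hα hβ, mul_add,
    Finset.sum_add_distrib, Finset.sum_mul, Finset.mul_sum, ← mul_assoc, parity,
    CliffordMultiplication.mulι_apply, ι_mul_eq_involute_mul_ι _ (α x)]

theorem parity_imathFun (hα : SuperDiffAt E F α x) :
    parity x (imathFun γ D η α x) = -imathFun γ D η (fun y ↦ parity y (α y)) x := by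
  have hodd (s : S x) : parity x (ExteriorAlgebra.ι 𝕜 s) = -ExteriorAlgebra.ι 𝕜 s :=
    involute_exteriorAlgebra_ι s
  simp only [imathFun, PseudoRiemannianMetric.contract, superDeriv_parity D hα, map_sum, map_mul,
    CliffordMultiplication.mulι_apply, hodd, neg_mul, Finset.sum_neg_distrib]

theorem imathFun_function {f : M → 𝕜} (hf : MDifferentiableAt 𝓘(ℝ, E) 𝓘(ℝ, 𝕜) f x) :
    imathFun γ D η (fun y ↦ algebraMap 𝕜 (ExteriorAlgebra 𝕜 (S y)) (f y)) x
      = g.contract x fun v w ↦ mvfderiv 𝓘(ℝ, E) f x w • ExteriorAlgebra.ι 𝕜 (γ.mul x v (η x)) := by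
  simp only [imathFun, superDeriv_function D hf, CliffordMultiplication.mulι_apply,
    ← Algebra.commutes, ← Algebra.smul_def]

variable [ContMDiffVectorBundle ∞ F S 𝓘(ℝ, E)]

theorem imathFun_spinor {ψ : Π y : M, S y} (hψ : MDiffAt (T% ψ) x) :
    imathFun γ D η (fun y ↦ ExteriorAlgebra.ι 𝕜 (ψ y)) x
      = g.contract x fun v w ↦
        ExteriorAlgebra.ι 𝕜 (γ.mul x v (η x)) * ExteriorAlgebra.ι 𝕜 (D.toFun ψ x w) := by
  simp only [imathFun, superDeriv_spinor D hψ, CliffordMultiplication.mulι_apply]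

variable [T2Space M]

theorem imathFun_mem (hη : CMDiff ∞ (T% η)) (hα : α ∈ SuperFunctions 𝕜 E F S) :
    imathFun γ D η α ∈ SuperFunctions 𝕜 E F S := by
  refine mem_superFunctions_of_locally fun x ↦ ?_
  obtain ⟨e, e', he, he', -, h⟩ := g.exists_dual_frame x
  refine ⟨∑ μ, (fun y ↦ γ.mulι (η y) (e' μ y)) * fun y ↦ superDeriv D y α (e μ y),
    sum_mem fun μ _ ↦ mul_mem (ofSpinor _ (γ.contMDiff_mul_apply (he' μ) hη)).2
      (superDeriv_mem D hα (he μ)), ?_⟩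
  filter_upwards [h] with y hy
  simp only [imathFun_eq_sum hy, Finset.sum_apply, Pi.mul_apply]

variable (γ D) in
/-- The odd vector field `γ^μ η ⊗ D_μ`. -/
def imath (hη : CMDiff ∞ (T% η)) : OddVectorField 𝕜 E F S where
  toFun α := ⟨imathFun γ D η α.1, imathFun_mem hη α.2⟩
  map_add' α β := Subtype.ext <| funext fun x ↦
    imathFun_add (superDiffAt_of_mem α.2 x) (superDiffAt_of_mem β.2 x)
  map_smul' c α := Subtype.ext <| funext fun x ↦ imathFun_smul (superDiffAt_of_mem α.2 x) c
  odd_of_even α hα x := by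
    refine (parity_imathFun (superDiffAt_of_mem α.2 x)).trans (congrArg Neg.neg ?_)
    simp only [hα]
  even_of_odd α hα x := by
    have h : (fun y ↦ parity y (α.1 y)) = (-1 : 𝕜) • α.1 := by
      ext y
      simp [hα]
    refine (parity_imathFun (superDiffAt_of_mem α.2 x)).trans ?_
    rw [h, imathFun_smul (superDiffAt_of_mem α.2 x), neg_smul, one_smul, neg_neg]
  leibniz α β x := imathFun_mul (superDiffAt_of_mem α.2 x) (superDiffAt_of_mem β.2 x)

theorem isImath_imath (hη : CMDiff ∞ (T% η)) : IsImath γ D η (imath γ D hη) :=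
  ⟨fun _ hf x ↦ imathFun_function (hf.mdifferentiable (by simp) x),
    fun _ hψ x ↦ imathFun_spinor (hψ.mdifferentiable (by simp) x)⟩

theorem IsImath.eq_imath (hη : CMDiff ∞ (T% η)) {Q : OddVectorField 𝕜 E F S}
    (hQ : IsImath γ D η Q) : Q = imath γ D hη :=
  OddVectorField.ext_of_generators
    (fun f hf ↦ Subtype.ext <| funext fun x ↦
      (hQ.1 f hf x).trans ((isImath_imath hη).1 f hf x).symm)
    (fun ψ hψ ↦ Subtype.ext <| funext fun x ↦
      (hQ.2 ψ hψ x).trans ((isImath_imath hη).2 ψ hψ x).symm)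

end Imath

theorem sum_mul_mul_eq_half_antisymmetrization {𝕜 A ι : Type*} [Field 𝕜] [NeZero (2 : 𝕜)] [Ring A]
    [Algebra 𝕜 A] [Fintype ι] {b : ι → A} (hb : ∀ ν ρ, b ν * b ρ = -(b ρ * b ν)) (N : ι → ι → A) :
    ∑ ν, ∑ ρ, b ν * b ρ * N ν ρ
      = (2⁻¹ : 𝕜) • ∑ ν, ∑ ρ, b ν * b ρ * (N ν ρ - N ρ ν) := by
  have hswap : ∑ ν, ∑ ρ, b ν * b ρ * N ρ ν = -∑ ν, ∑ ρ, b ν * b ρ * N ν ρ := by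
    simp only [← Finset.sum_neg_distrib, ← neg_mul, ← hb]
    exact Finset.sum_comm
  simp only [mul_sub, Finset.sum_sub_distrib]
  rw [hswap, sub_neg_eq_add, ← two_smul 𝕜, smul_smul, inv_mul_cancel₀ two_ne_zero, one_smul]

section LeviCivita

variable {E : Type*} [NormedAddCommGroup E] [NormedSpace ℝ E] [FiniteDimensional ℝ E]
  {M : Type*} [TopologicalSpace M] [ChartedSpace E M] [IsManifold 𝓘(ℝ, E) ∞ M]
  {g : PseudoRiemannianMetric E M}
  {nabla : CovariantDerivative 𝓘(ℝ, E) E (TangentSpace 𝓘(ℝ, E) : M → Type _)}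

theorem PseudoRiemannianMetric.IsLeviCivita.sum_nabla_dual_frame (hnabla : g.IsLeviCivita nabla)
    {x : M} {e e' : Fin (Module.finrank ℝ E) → Π y : M, TangentSpace 𝓘(ℝ, E) y}
    (he : ∀ μ, MDiffAt (T% (e μ)) x) (he' : ∀ μ, MDiffAt (T% (e' μ)) x)
    (h : ∀ᶠ y in 𝓝 x, g.IsDualFrame (e' · y) (e · y)) {W : Type*} [AddCommGroup W] [Module ℝ W]
    (B : TangentSpace 𝓘(ℝ, E) x →ₗ[ℝ] TangentSpace 𝓘(ℝ, E) x →ₗ[ℝ] W)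
    (v : TangentSpace 𝓘(ℝ, E) x) :
    ∑ μ, B (nabla (e' μ) x v) (e μ x) = -∑ μ, B (e' μ x) (nabla (e μ) x v) := by
  have hmetric (μ ρ) : g.val x (e ρ x) (nabla (e' μ) x v)
      = -g.val x (e' μ x) (nabla (e ρ) x v) := by
    have hconst : (fun y ↦ g.val y (e' μ y) (e ρ y)) =ᶠ[𝓝 x] fun _ ↦ if μ = ρ then (1 : ℝ) else 0 :=
      h.mono fun y hy ↦ hy μ ρ
    have hderiv := hnabla.2 (e' μ) (e ρ) x (he' μ) (he ρ) v
    rw [mvfderiv_congr hconst, mvfderiv_const, zero_apply] at hderiv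
    rw [g.symm]
    linarith
  calc ∑ μ, B (nabla (e' μ) x v) (e μ x)
      = ∑ μ, ∑ ρ, -(g.val x (e' μ x) (nabla (e ρ) x v) • B (e' ρ x) (e μ x)) := by
        refine Finset.sum_congr rfl fun μ _ ↦ ?_
        conv_lhs => rw [← h.self_of_nhds.symm.sum_val_smul (nabla (e' μ) x v)]
        simp only [hmetric, neg_smul, map_sum, map_neg, map_smul, LinearMap.sum_apply,
          LinearMap.neg_apply, LinearMap.smul_apply]
    _ = -∑ ρ, B (e' ρ x) (∑ μ, g.val x (e' μ x) (nabla (e ρ) x v) • e μ x) := by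
        simp only [Finset.sum_neg_distrib, map_sum, map_smul]
        rw [Finset.sum_comm]
    _ = -∑ ρ, B (e' ρ x) (nabla (e ρ) x v) := by simp only [h.self_of_nhds.sum_val_smul]

end LeviCivita

section SecondDerivative

variable {𝕜 : Type*} [RCLike 𝕜]
  {E : Type*} [NormedAddCommGroup E] [NormedSpace ℝ E]
  {M : Type*} [TopologicalSpace M] [ChartedSpace E M] [IsManifold 𝓘(ℝ, E) ∞ M]
  {F : Type*} [NormedAddCommGroup F] [NormedSpace ℝ F] [NormedSpace 𝕜 F] [IsScalarTower ℝ 𝕜 F]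
  [FiniteDimensional ℝ F]
  {S : M → Type*} [TopologicalSpace (TotalSpace F S)] [∀ x, AddCommGroup (S x)]
  [∀ x, Module ℝ (S x)] [∀ x, Module 𝕜 (S x)] [∀ x, IsScalarTower ℝ 𝕜 (S x)]
  [∀ x, TopologicalSpace (S x)] [∀ x, IsTopologicalAddGroup (S x)]
  [∀ x, ContinuousSMul ℝ (S x)] [FiberBundle F S] [VectorBundle ℝ F S] [VectorBundle 𝕜 F S]
  (D : SpinorConnection 𝕜 E F S)

/-- The operator `D_V D_W - D_W D_V - D_{[V, W]}` on sections of the bundle of exterior algebras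
of `S`. -/
def superCurvatureOp (V W : Π y : M, TangentSpace 𝓘(ℝ, E) y)
    (α : Π y : M, ExteriorAlgebra 𝕜 (S y)) (x : M) : ExteriorAlgebra 𝕜 (S x) :=
  superDeriv D x (fun y ↦ superDeriv D y α (W y)) (V x)
    - superDeriv D x (fun y ↦ superDeriv D y α (V y)) (W x)
    - superDeriv D x α (VectorField.mlieBracket 𝓘(ℝ, E) V W x)

variable {V W : Π y : M, TangentSpace 𝓘(ℝ, E) y}

theorem superCurvatureOp_function [FiniteDimensional ℝ E] {f : M → 𝕜}
    (hf : ContMDiff 𝓘(ℝ, E) 𝓘(ℝ, 𝕜) ∞ f) (hV : CMDiff ∞ (T% V)) (hW : CMDiff ∞ (T% W)) (x : M) :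
    superCurvatureOp D V W (fun y ↦ algebraMap 𝕜 (ExteriorAlgebra 𝕜 (S y)) (f y)) x = 0 := by
  simp only [superCurvatureOp, superDeriv_function D (hf.mdifferentiable (by simp) _)]
  rw [superDeriv_function D ((contMDiff_mvfderiv_apply hf hV).mdifferentiable (by simp) x),
    superDeriv_function D ((contMDiff_mvfderiv_apply hf hW).mdifferentiable (by simp) x),
    mvfderiv_mlieBracket hf hV hW, map_sub, sub_self]

theorem superCurvatureOp_spinor [ContMDiffVectorBundle ∞ F S 𝓘(ℝ, E)] {ψ : Π y : M, S y}
    (hψ : CMDiff ∞ (T% ψ)) (hV : CMDiff ∞ (T% V)) (hW : CMDiff ∞ (T% W)) (x : M) :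
    superCurvatureOp D V W (fun y ↦ ExteriorAlgebra.ι 𝕜 (ψ y)) x
      = ExteriorAlgebra.ι 𝕜 (D.curvatureOp V W ψ x) := by
  simp only [superCurvatureOp, superDeriv_spinor D (hψ.mdifferentiable (by simp) _)]
  rw [superDeriv_spinor D ((D.contMDiff_apply hψ hV).mdifferentiable (by simp) x),
    superDeriv_spinor D ((D.contMDiff_apply hψ hW).mdifferentiable (by simp) x),
    SpinorConnection.curvatureOp, map_sub, map_sub]

end SecondDerivative

section Square

variable {𝕜 : Type*} [RCLike 𝕜]
  {E : Type*} [NormedAddCommGroup E] [NormedSpace ℝ E] [FiniteDimensional ℝ E]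
  {M : Type*} [TopologicalSpace M] [ChartedSpace E M] [IsManifold 𝓘(ℝ, E) ∞ M]
  {F : Type*} [NormedAddCommGroup F] [NormedSpace ℝ F] [NormedSpace 𝕜 F] [IsScalarTower ℝ 𝕜 F]
  [FiniteDimensional ℝ F]
  {S : M → Type*} [TopologicalSpace (TotalSpace F S)] [∀ x, AddCommGroup (S x)]
  [∀ x, Module ℝ (S x)] [∀ x, Module 𝕜 (S x)] [∀ x, IsScalarTower ℝ 𝕜 (S x)]
  [∀ x, TopologicalSpace (S x)] [∀ x, IsTopologicalAddGroup (S x)]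
  [∀ x, ContinuousSMul ℝ (S x)] [FiberBundle F S] [VectorBundle ℝ F S] [VectorBundle 𝕜 F S]
  [ContMDiffVectorBundle ∞ F S 𝓘(ℝ, E)]
  {g : PseudoRiemannianMetric E M} {γ : CliffordMultiplication 𝕜 g F S}
  {C : ChargeConjugation γ} {D : SpinorConnection 𝕜 E F S}
  {nabla : CovariantDerivative 𝓘(ℝ, E) E (TangentSpace 𝓘(ℝ, E) : M → Type _)} {η : Π x : M, S x}

variable (C D nabla η) in
/-- The map `w ↦ γ^ν η ∧ (D̂_ν γ)(w) η`, which for admissible `D` is half the contraction of `γ η`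
with the torsion of `D`. -/
def torsionForm (x : M) : TangentSpace 𝓘(ℝ, E) x →ₗ[ℝ] ExteriorAlgebra 𝕜 (S x) :=
  ∑ ν, (LinearMap.mulLeft ℝ (γ.mulι (η x) (g.coframe x ν))) ∘ₗ
    ((ExteriorAlgebra.ι 𝕜).restrictScalars ℝ) ∘ₗ
      (hatDHom C D nabla x (PseudoRiemannianMetric.frame x ν) (η x)).toLinearMap

theorem torsionForm_apply (x : M) (w : TangentSpace 𝓘(ℝ, E) x) :
    torsionForm C D nabla η x w = ∑ ν, γ.mulι (η x) (g.coframe x ν)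
      * ExteriorAlgebra.ι 𝕜 (hatD C D nabla x (PseudoRiemannianMetric.frame x ν) w (η x)) := by
  simp [torsionForm, hatDHom_apply]

theorem superDeriv_mulι {x : M} (hη : MDiffAt (T% η) x) (hparallel : C.conj D η x = 0)
    {W : Π y : M, TangentSpace 𝓘(ℝ, E) y} (hW : MDiffAt (T% W) x) (v : TangentSpace 𝓘(ℝ, E) x) :
    superDeriv D x (fun y ↦ γ.mulι (η y) (W y)) v
      = ExteriorAlgebra.ι 𝕜 (hatD C D nabla x v (W x) (η x)) + γ.mulι (η x) (nabla W x v) := by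
  rw [hatD_apply C D nabla v hW hη, hatDOp, hparallel, zero_apply, map_zero, sub_zero,
    CliffordMultiplication.mulι_apply, ← map_add, sub_add_cancel]
  exact superDeriv_spinor D (γ.mdifferentiableAt_mul hW hη) v

section DualFrame

variable {α : Π y : M, ExteriorAlgebra 𝕜 (S y)}
  (hnabla : g.IsLeviCivita nabla) (hη : CMDiff ∞ (T% η))
  (hparallel : ∀ x, C.conj D η x = 0)
  {x : M} {e e' : Fin (Module.finrank ℝ E) → Π y : M, TangentSpace 𝓘(ℝ, E) y}
  (he : ∀ μ, CMDiff ∞ (T% (e μ))) (he' : ∀ μ, CMDiff ∞ (T% (e' μ)))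
  (h : ∀ᶠ y in 𝓝 x, g.IsDualFrame (e' · y) (e · y))

include hnabla hη hparallel he he' h

theorem superDeriv_imathFun (hα : α ∈ SuperFunctions 𝕜 E F S) (v : TangentSpace 𝓘(ℝ, E) x) :
    superDeriv D x (imathFun γ D η α) v
      = ∑ μ, ExteriorAlgebra.ι 𝕜 (hatD C D nabla x v (e' μ x) (η x)) * superDeriv D x α (e μ x)
        + ∑ μ, γ.mulι (η x) (e' μ x) * (superDeriv D x (fun y ↦ superDeriv D y α (e μ y)) v
          - superDeriv D x α (nabla (e μ) x v)) := by
  have hb (μ) : (fun y ↦ γ.mulι (η y) (e' μ y)) ∈ SuperFunctions 𝕜 E F S :=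
    (ofSpinor _ (γ.contMDiff_mul_apply (he' μ) hη)).2
  have hα' (μ) : (fun y ↦ superDeriv D y α (e μ y)) ∈ SuperFunctions 𝕜 E F S :=
    superDeriv_mem D hα (he μ)
  have hsum : ∀ᶠ y in 𝓝 x, imathFun γ D η α y
      = (∑ μ, (fun y ↦ γ.mulι (η y) (e' μ y)) * fun y ↦ superDeriv D y α (e μ y)) y := by
    filter_upwards [h] with y hy
    simp only [imathFun_eq_sum hy, Finset.sum_apply, Pi.mul_apply]
  -- Since `g` is parallel, the derivatives of `e'` can be moved to `e`.
  have hframe := hnabla.sum_nabla_dual_frame (fun μ ↦ (he μ).mdifferentiable (by simp) x)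
    (fun μ ↦ (he' μ).mdifferentiable (by simp) x) h
    ((LinearMap.mul ℝ (ExteriorAlgebra 𝕜 (S x))).compl₁₂ (γ.mulι (η x)) (superDeriv D x α)) v
  simp only [LinearMap.compl₁₂_apply, LinearMap.mul_apply'] at hframe
  rw [superDeriv_congr D hsum, superDeriv_sum D _ fun μ ↦ mul_mem (hb μ) (hα' μ),
    LinearMap.sum_apply]
  simp only [superDeriv_mul D (superDiffAt_of_mem (hb _) x) (superDiffAt_of_mem (hα' _) x),
    superDeriv_mulι (nabla := nabla) (hη.mdifferentiable (by simp) x) (hparallel x)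
      ((he' _).mdifferentiable (by simp) x), add_mul, mul_sub, Finset.sum_add_distrib,
    Finset.sum_sub_distrib, hframe]
  abel

theorem imathFun_imathFun (hex : ∀ μ, e μ x = PseudoRiemannianMetric.frame x μ)
    (hα : α ∈ SuperFunctions 𝕜 E F S) :
    imathFun γ D η (imathFun γ D η α) x
      = g.contract x (fun v w ↦ torsionForm C D nabla η x v * superDeriv D x α w)
        + (2⁻¹ : 𝕜) • ∑ ν, ∑ ρ, γ.mulι (η x) (g.coframe x ν) * γ.mulι (η x) (g.coframe x ρ)
          * superCurvatureOp D (e ν) (e ρ) α x := by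
  have hex' (μ) : e' μ x = g.coframe x μ := by
    rw [← (g.isDualFrame_coframe x).symm.sum_val_smul (e' μ x)]
    simp [← hex, g.symm x _ (e' μ x), h.self_of_nhds μ]
  let N ν ρ := superDeriv D x (fun y ↦ superDeriv D y α (e ρ y)) (e ν x)
    - superDeriv D x α (nabla (e ρ) x (e ν x))
  have hN (ν ρ) : superCurvatureOp D (e ν) (e ρ) α x = N ν ρ - N ρ ν := by
    rw [superCurvatureOp, ← hnabla.1 (e ν) (e ρ) x ((he ν).mdifferentiable (by simp) x)
      ((he ρ).mdifferentiable (by simp) x), map_sub]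
    exact sub_sub_sub_comm _ _ _ _
  simp only [hN]
  have hswap (ν ρ) : γ.mulι (η x) (g.coframe x ν) * γ.mulι (η x) (g.coframe x ρ)
      = -(γ.mulι (η x) (g.coframe x ρ) * γ.mulι (η x) (g.coframe x ν)) :=
    exteriorAlgebra_ι_mul_swap _ _
  rw [← sum_mul_mul_eq_half_antisymmetrization hswap N]
  simp only [imathFun_eq_sum (α := imathFun γ D η α) h.self_of_nhds,
    superDeriv_imathFun hnabla hη hparallel he he' h hα, mul_add, Finset.sum_add_distrib]
  congr 1
  · simp only [PseudoRiemannianMetric.contract, torsionForm_apply, Finset.mul_sum,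
      Finset.sum_mul, mul_assoc, hex', hex]
    exact Finset.sum_comm
  · simp only [Finset.mul_sum, mul_assoc, hex', N]

end DualFrame

variable [T2Space M] {α β : Π y : M, ExteriorAlgebra 𝕜 (S y)}

theorem imathFun_imathFun_mul (hη : CMDiff ∞ (T% η)) (hα : α ∈ SuperFunctions 𝕜 E F S)
    (hβ : β ∈ SuperFunctions 𝕜 E F S) (x : M) :
    imathFun γ D η (imathFun γ D η (α * β)) x
      = imathFun γ D η (imathFun γ D η α) x * β x + α x * imathFun γ D η (imathFun γ D η β) x := by
  have hα' : imathFun γ D η α ∈ SuperFunctions 𝕜 E F S := imathFun_mem hη hα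
  have hβ' : imathFun γ D η β ∈ SuperFunctions 𝕜 E F S := imathFun_mem hη hβ
  have hparity := parity_mem_superFunctions hα
  have hmul : imathFun γ D η (α * β)
      = imathFun γ D η α * β + (fun y ↦ parity y (α y)) * imathFun γ D η β :=
    funext fun y ↦ imathFun_mul (superDiffAt_of_mem hα y) (superDiffAt_of_mem hβ y)
  have hinvol : parity x (parity x (α x)) = α x := CliffordAlgebra.involute_involute _
  rw [hmul, imathFun_add (superDiffAt_of_mem (mul_mem hα' hβ) x)
      (superDiffAt_of_mem (mul_mem hparity hβ') x),
    imathFun_mul (superDiffAt_of_mem hα' x) (superDiffAt_of_mem hβ x),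
    imathFun_mul (superDiffAt_of_mem hparity x) (superDiffAt_of_mem hβ' x),
    parity_imathFun (superDiffAt_of_mem hα x), hinvol]
  noncomm_ring

theorem isDifferential_imath_of_generators (hη : CMDiff ∞ (T% η))
    (function : ∀ (f : M → 𝕜), ContMDiff 𝓘(ℝ, E) 𝓘(ℝ, 𝕜) ∞ f → ∀ x : M, imathFun γ D η
      (imathFun γ D η fun y ↦ algebraMap 𝕜 (ExteriorAlgebra 𝕜 (S y)) (f y)) x = 0)
    (spinor : ∀ (ψ : Π x : M, S x), CMDiff ∞ (T% ψ) →
      ∀ x : M, imathFun γ D η (imathFun γ D η fun y ↦ ExteriorAlgebra.ι 𝕜 (ψ y)) x = 0) :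
    (imath γ D hη).IsDifferential := by
  suffices h : ∀ α ∈ SuperFunctions 𝕜 E F S, ∀ x, imathFun γ D η (imathFun γ D η α) x = 0 from
    fun α ↦ Subtype.ext <| funext <| h α.1 α.2
  intro α hα
  induction hα using SuperFunctions.induction with
  | function f hf _ => exact function f hf
  | spinor ψ hψ _ => exact spinor ψ hψ
  | add α β hα hβ h h' =>
    intro x
    have hadd : imathFun γ D η (α + β) = imathFun γ D η α + imathFun γ D η β :=
      funext fun y ↦ imathFun_add (superDiffAt_of_mem hα y) (superDiffAt_of_mem hβ y)
    rw [hadd, imathFun_add (superDiffAt_of_mem (imathFun_mem hη hα) x)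
      (superDiffAt_of_mem (imathFun_mem hη hβ) x), h, h', add_zero]
  | mul α β hα hβ h h' =>
    intro x
    rw [imathFun_imathFun_mul hη hα hβ, h, h', zero_mul, mul_zero, add_zero]
  | locally α _ h =>
    intro x
    obtain ⟨β, _, hβ, hαβ⟩ := h x
    rw [imathFun_congr (hαβ.eventually_nhds.mono fun y hy ↦ imathFun_congr hy), hβ]

end Square

theorem PseudoRiemannianMetric.contract_mul_algebraMap_val {𝕜 : Type*} [RCLike 𝕜]
    {E : Type*} [NormedAddCommGroup E] [NormedSpace ℝ E] [FiniteDimensional ℝ E]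
    {M : Type*} [TopologicalSpace M] [ChartedSpace E M] [IsManifold 𝓘(ℝ, E) ∞ M]
    (g : PseudoRiemannianMetric E M) {A : Type*} [Ring A] [Algebra 𝕜 A] [Module ℝ A]
    [IsScalarTower ℝ 𝕜 A] {x : M} (θ : TangentSpace 𝓘(ℝ, E) x →ₗ[ℝ] A)
    (v : TangentSpace 𝓘(ℝ, E) x) :
    g.contract x (fun u w ↦ θ u * algebraMap 𝕜 A (g.val x v w : ℝ)) = θ v := by
  have hv : ∑ μ, g.val x v (frame x μ) • g.coframe x μ = v := by
    simpa only [g.symm x v] using (g.isDualFrame_coframe x).symm.sum_val_smul v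
  conv_rhs => rw [← hv, map_sum]
  refine Finset.sum_congr rfl fun μ _ ↦ ?_
  rw [map_smul, ← algebraMap_smul 𝕜, Algebra.smul_def, Algebra.commutes,
    RCLike.algebraMap_eq_ofReal]

section Main

variable {𝕜 : Type*} [RCLike 𝕜]
  {E : Type*} [NormedAddCommGroup E] [NormedSpace ℝ E] [FiniteDimensional ℝ E]
  {M : Type*} [TopologicalSpace M] [ChartedSpace E M] [IsManifold 𝓘(ℝ, E) ∞ M]
  {F : Type*} [NormedAddCommGroup F] [NormedSpace ℝ F] [NormedSpace 𝕜 F] [IsScalarTower ℝ 𝕜 F]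
  [FiniteDimensional ℝ F]
  {S : M → Type*} [TopologicalSpace (TotalSpace F S)] [∀ x, AddCommGroup (S x)]
  [∀ x, Module ℝ (S x)] [∀ x, Module 𝕜 (S x)] [∀ x, IsScalarTower ℝ 𝕜 (S x)]
  [∀ x, TopologicalSpace (S x)] [∀ x, IsTopologicalAddGroup (S x)]
  [∀ x, ContinuousSMul ℝ (S x)] [FiberBundle F S] [VectorBundle ℝ F S] [VectorBundle 𝕜 F S]
  [ContMDiffVectorBundle ∞ F S 𝓘(ℝ, E)]
  {g : PseudoRiemannianMetric E M} {γ : CliffordMultiplication 𝕜 g F S}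
  {C : ChargeConjugation γ} {D : SpinorConnection 𝕜 E F S}
  {nabla : CovariantDerivative 𝓘(ℝ, E) E (TangentSpace 𝓘(ℝ, E) : M → Type _)} {η : Π x : M, S x}

theorem IsAdmissible.fieldD_eq_sum_torsionForm (hadm : IsAdmissible C D nabla {η}) (x : M) :
    fieldD C D nabla η η x = ∑ ν, ((4 : 𝕜) • torsionForm C D nabla η x
      (PseudoRiemannianMetric.frame x ν)) ⊗ₜ[ℝ] g.coframe x ν := by
  have htorsion (v w : TangentSpace 𝓘(ℝ, E) x) :
      torsion C D nabla x v w (η x) = (2 : 𝕜) • hatD C D nabla x v w (η x) := by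
    rw [torsion, eq_neg_of_add_eq_zero_right (hadm η rfl x v w), sub_neg_eq_add, two_smul]
  rw [fieldD, PseudoRiemannianMetric.contract]
  refine Finset.sum_congr rfl fun ν _ ↦ congrArg (· ⊗ₜ[ℝ] g.coframe x ν) ?_
  rw [torsionForm_apply, Finset.smul_sum, PseudoRiemannianMetric.contract]
  refine Finset.sum_congr rfl fun μ _ ↦ ?_
  rw [htorsion, map_smul, mul_smul_comm, ← add_smul, γ.mulι_apply]
  norm_num

theorem IsAdmissible.fieldD_eq_zero_iff (hadm : IsAdmissible C D nabla {η}) (x : M) :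
    fieldD C D nabla η η x = 0 ↔ torsionForm C D nabla η x = 0 := by
  rw [hadm.fieldD_eq_sum_torsionForm]
  refine ⟨fun h ↦ (PseudoRiemannianMetric.frame x).ext fun ν ↦ ?_, fun h ↦ by simp [h]⟩
  have hcoeff := TensorProduct.sum_tmul_basis_right_eq_zero (g.coframe x)
    (Finsupp.equivFunOnFinite.symm fun ν ↦ (4 : 𝕜) • torsionForm C D nabla η x
      (PseudoRiemannianMetric.frame x ν))
    (by rwa [Finsupp.sum_fintype _ _ (by simp)])
  exact (smul_eq_zero.1 (DFunLike.congr_fun hcoeff ν)).resolve_left (by norm_num)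

variable [T2Space M]

section SquareOnGenerators

variable (hnabla : g.IsLeviCivita nabla) (hη : CMDiff ∞ (T% η))
  (hparallel : ∀ x, C.conj D η x = 0)

include hnabla hη hparallel

theorem imathFun_imathFun_function {f : M → 𝕜} (hf : ContMDiff 𝓘(ℝ, E) 𝓘(ℝ, 𝕜) ∞ f) (x : M) :
    imathFun γ D η (imathFun γ D η fun y ↦ algebraMap 𝕜 (ExteriorAlgebra 𝕜 (S y)) (f y)) x
      = g.contract x fun v w ↦ torsionForm C D nabla η x v
        * algebraMap 𝕜 (ExteriorAlgebra 𝕜 (S x)) (mvfderiv 𝓘(ℝ, E) f x w) := by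
  obtain ⟨e, e', he, he', hex, h⟩ := g.exists_dual_frame x
  refine (imathFun_imathFun hnabla hη hparallel he he' h
    (fun μ ↦ (hex μ).self_of_nhds.trans (FiberBundle.extend_apply_self _ _))
    (ofFunction f hf).2).trans ?_
  simp only [ofFunction, superCurvatureOp_function D hf (he _) (he _), mul_zero,
    Finset.sum_const_zero, smul_zero, add_zero,
    superDeriv_function D (hf.mdifferentiable (by simp) x)]

theorem imathFun_imathFun_spinor {ψ : Π y : M, S y} (hψ : CMDiff ∞ (T% ψ)) (x : M) :
    imathFun γ D η (imathFun γ D η fun y ↦ ExteriorAlgebra.ι 𝕜 (ψ y)) x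
      = g.contract x (fun v w ↦ torsionForm C D nabla η x v
        * ExteriorAlgebra.ι 𝕜 (D.toFun ψ x w)) + (2⁻¹ : 𝕜) • fieldB γ D η η x (ψ x) := by
  obtain ⟨e, e', he, he', hex, h⟩ := g.exists_dual_frame x
  refine (imathFun_imathFun hnabla hη hparallel he he' h
    (fun μ ↦ (hex μ).self_of_nhds.trans (FiberBundle.extend_apply_self _ _))
    (ofSpinor ψ hψ).2).trans ?_
  simp only [ofSpinor, superCurvatureOp_spinor D hψ (he _) (he _),
    D.curvatureOp_eq_curvature (he _) (he _) (hex _) (hex _) hψ,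
    superDeriv_spinor D (hψ.mdifferentiable (by simp) x)]
  rfl

theorem torsionForm_eq_zero_of_isDifferential (h : (imath γ D hη).IsDifferential) (x : M) :
    torsionForm C D nabla η x = 0 := by
  ext v
  obtain ⟨f, hf, hfx⟩ := exists_contMDiff_mvfderiv_eq x (g.val x v)
  have hf' : ContMDiff 𝓘(ℝ, E) 𝓘(ℝ, 𝕜) ∞ fun y ↦ (f y : 𝕜) :=
    (RCLike.ofRealCLM (K := 𝕜)).contMDiff.comp hf
  have hderiv (w : TangentSpace 𝓘(ℝ, E) x) :
      mvfderiv 𝓘(ℝ, E) (fun y ↦ (f y : 𝕜)) x w = (g.val x v w : ℝ) := by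
    rw [← hfx]
    exact mvfderiv_clm_comp (RCLike.ofRealCLM (K := 𝕜)) (hf.mdifferentiable (by simp) x) w
  have hsquare := imathFun_imathFun_function hnabla hη hparallel hf' x
  simp only [hderiv, g.contract_mul_algebraMap_val] at hsquare
  exact hsquare.symm.trans (congrArg (fun α ↦ α.1 x) (h (ofFunction _ hf')))

theorem fieldB_eq_zero_of_isDifferential (h : (imath γ D hη).IsDifferential) (x : M) (s : S x) :
    fieldB γ D η η x s = 0 := by
  obtain ⟨ψ, hψ, -, rfl⟩ := exists_contMDiff_section_apply_eq (E := E) (F := F) s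
  have hsquare : imathFun γ D η (imathFun γ D η fun y ↦ ExteriorAlgebra.ι 𝕜 (ψ y)) x = 0 :=
    congrArg (fun α ↦ α.1 x) (h (ofSpinor _ hψ))
  rw [imathFun_imathFun_spinor hnabla hη hparallel hψ] at hsquare
  simp only [torsionForm_eq_zero_of_isDifferential hnabla hη hparallel h,
    PseudoRiemannianMetric.contract, LinearMap.zero_apply, zero_mul, Finset.sum_const_zero,
    zero_add] at hsquare
  exact (smul_eq_zero.1 hsquare).resolve_left (inv_ne_zero two_ne_zero)

theorem isDifferential_imath_of_torsionForm_fieldB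
    (htorsion : ∀ x, torsionForm C D nabla η x = 0) (hB : ∀ x s, fieldB γ D η η x s = 0) :
    (imath γ D hη).IsDifferential := by
  refine isDifferential_imath_of_generators hη (fun f hf x ↦ ?_) fun ψ hψ x ↦ ?_
  · rw [imathFun_imathFun_function hnabla hη hparallel hf]
    simp [htorsion, PseudoRiemannianMetric.contract]
  · rw [imathFun_imathFun_spinor hnabla hη hparallel hψ, hB]
    simp [htorsion, PseudoRiemannianMetric.contract]

theorem isDifferential_imath_iff_isFlat (hadm : IsAdmissible C D nabla {η}) :
    (imath γ D hη).IsDifferential ↔ IsFlat C D nabla {η} := by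
  constructor
  · rintro h φ rfl ψ rfl
    exact ⟨fieldB_eq_zero_of_isDifferential hnabla hη hparallel h, fun x ↦
      (hadm.fieldD_eq_zero_iff x).2 (torsionForm_eq_zero_of_isDifferential hnabla hη hparallel h x)⟩
  · intro h
    obtain ⟨hB, hD⟩ := h η rfl η rfl
    exact isDifferential_imath_of_torsionForm_fieldB hnabla hη hparallel
      (fun x ↦ (hadm.fieldD_eq_zero_iff x).1 (hD x)) hB

end SquareOnGenerators

end Main

end SpinSuper

end

theorem proposition5p4 {𝕜 : Type*} [RCLike 𝕜]
    {E : Type*} [NormedAddCommGroup E] [NormedSpace ℝ E] [FiniteDimensional ℝ E]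
    {M : Type*} [TopologicalSpace M] [T2Space M] [ChartedSpace E M] [IsManifold 𝓘(ℝ, E) ∞ M]
    {F : Type*} [NormedAddCommGroup F] [NormedSpace ℝ F] [NormedSpace 𝕜 F] [IsScalarTower ℝ 𝕜 F]
    [FiniteDimensional ℝ F]
    {S : M → Type*} [TopologicalSpace (TotalSpace F S)]
    [∀ x, AddCommGroup (S x)] [∀ x, Module ℝ (S x)] [∀ x, Module 𝕜 (S x)]
    [∀ x, IsScalarTower ℝ 𝕜 (S x)]
    [∀ x, TopologicalSpace (S x)] [∀ x, IsTopologicalAddGroup (S x)] [∀ x, ContinuousSMul ℝ (S x)]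
    [FiberBundle F S] [VectorBundle ℝ F S] [VectorBundle 𝕜 F S]
    [ContMDiffVectorBundle ∞ F S 𝓘(ℝ, E)]
    (g : PseudoRiemannianMetric E M)
    (nabla : CovariantDerivative 𝓘(ℝ, E) E (TangentSpace 𝓘(ℝ, E) : M → Type _))
    (hnabla : g.IsLeviCivita nabla)
    (γ : CliffordMultiplication 𝕜 g F S) (C : ChargeConjugation γ)
    (D : SpinorConnection 𝕜 E F S)
    (η : Π x : M, S x) (hη : ContMDiff 𝓘(ℝ, E) (𝓘(ℝ, E).prod 𝓘(ℝ, F)) ∞ (T% η))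
    (hparallel : ∀ x, C.conj D η x = 0)
    (hadm : IsAdmissible C D nabla {η}) :
    (∃! Q : OddVectorField 𝕜 E F S, IsImath γ D η Q) ∧
    ∀ Q : OddVectorField 𝕜 E F S, IsImath γ D η Q →
      (Q.IsDifferential ↔ IsFlat C D nabla {η}) := by
  refine ⟨⟨imath γ D hη, isImath_imath hη, fun Q hQ ↦ hQ.eq_imath hη⟩, fun Q hQ ↦ ?_⟩
  rw [hQ.eq_imath hη]
  exact isDifferential_imath_iff_isFlat hnabla hη hparallel hadm
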